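/- Let $m=ab$ and $n=2^m-1=r_1r_2$, where $r_1=2^a-1$, $\gcd(r_1,r_2)=1$ and $r_1,r_2>1$. Let $K$ be the field with $2^m$ elements, $\alpha\in K$ a primitive $n$-th root of unity, and $T:\mathbb Z_n\to\mathbb Z_{r_1}\times\mathbb Z_{r_2}$ an arbitrary isomorphism of groups. Residues are identified with their canonical representatives. **Codes.** For $0<\rho<m$, the Reed--Muller code $R(\rho,m)$ is the binary code, with coordinates indexed by $K$, of all $(x_g)_{g\in K}\in\mathbb F_2^K$ such that $\sum_{g\in K}x_g g^s=0$ (with $0^0=1$) for all $0\le s<2^m-1$ whose sum of binary digits is less than $m-\rho$. Its puncturing at the position $0\in K$ is the cyclic code $R^*(\rho,m)$ of length $n$, whose $i$-th coordinate ($i\in\mathbb Z_n$) is the coordinate at $\alpha^i$. An information set of a binary code $C$ is a set $I$ of $\dim C$ coordinates such that the restriction $C\to\mathbb F_2^I$ is onto; a set of check positions is the complement of an information set. **The construction.** Let $\mathcal D^*=\{e\in\mathbb Z_n : \sum_i c_i\alpha^{ei}=0 \text{ for all } c\in R^*(m-3,m)\}$ be the defining set of $R^*(m-3,m)$ with respect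 to $\alpha$. Let $\beta_1,\beta_2\in K$ be primitive $r_1$-th and $r_2$-th roots of unity. There is an abelian code (ideal) $\mathcal C\subseteq\mathbb F_2[X,Y]/(X^{r_1}-1,Y^{r_2}-1)$ with defining set $\mathcal D=\{(e_1,e_2) : P(\beta_1^{e_1},\beta_2^{e_2})=0 \text{ for all } P\in\mathcal C\}$ equal to $T(\mathcal D^*)$. For such a $\mathcal C$, let $\overline{\mathcal D}\subseteq\mathcal D$ be a set of restricted representatives: one element of each orbit of multiplication by $2$ in $\mathcal D$, such that the first projection $\overline{\mathcal D}_1$ contains exactly one element of each $2$-cyclotomic coset modulo $r_1$ that meets the first projection of $\mathcal D$ (such sets exist). Put $$m(e_1)=|\{2^ie_1 : i\ge0\}|,\qquad m(e_1,e_2)=|\{2^{m(e_1)i}e_2 : i\ge0\}|,\qquad M(e_1)=\sum_{e_2:\,(e_1,e_2)\in\overline{\mathcal D}}m(e_1,e_2),$$ the first two cardinalities being taken in $\mathbb Z_{r_1}$ and in $\mathbb Z_{r_2}$. Let $f_1>\dots>f_s$ be the distinct values of $M$ on $\overline{\mathcal D}_1$, let $f_{s+1}=0$, let $g_j=\sum_{e_1\in\overline{\mathcal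 D}_1,\,M(e_1)\ge f_j}m(e_1)$, and let $$\Gamma(\mathcal C)=\{(i_1,i_2) : \text{there is } 1\le j\le s \text{ with } f_{j+1}\le i_2<f_j \text{ and } 0\le i_1<g_j\}.$$ **Theorem.** For every choice of $\beta_1,\beta_2$, of $\mathcal C$ and of $\overline{\mathcal D}$ as above one has $s=2$, $$f_1=b^2,\quad f_2=\frac{b(b+1)}2,\quad g_1=\frac{a(a-1)}2,\quad g_2=\frac{a(a+1)}2,$$ and $\Gamma(\mathcal C)=\Gamma$, where $\Gamma$ is the set of all $(i_1,i_2)\in\mathbb Z_{r_1}\times\mathbb Z_{r_2}$ such that $$0\le i_1<\tfrac{a(a-1)}2 \text{ and } 0\le i_2<b^2,\qquad\text{or}\qquad \tfrac{a(a-1)}2\le i_1<\tfrac{a(a+1)}2 \text{ and } 0\le i_2<\tfrac{b(b+1)}2.$$ Moreover, $T^{-1}(\Gamma)$ is a set of check positions for $R^*(m-3,m)$, the set $\{0\}\cup\{\alpha^i : i\in T^{-1}(\Gamma)\}$ is an information set for $R(2,m)$, and $\{\alpha^i : i\notin T^{-1}(\Gamma)\}$ is an information set for $R(m-3,m)$.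 -/

import Mathlib

namespace ReedMullerInfo

/-! ## Binary linear codes, information sets and check positions -/

/-- A binary linear code with coordinates indexed by `ι`. -/
abbrev BinaryCode (ι : Type*) := Submodule (ZMod 2) (ι → ZMod 2)

/-- `I` is an information set for `C`: it has `dim C` elements, and the restrictions of the
codewords to `I` are all the binary vectors indexed by `I`. -/
def IsInformationSet {ι : Type*} (C : BinaryCode ι) (I : Set ι) : Prop :=
  I.Finite ∧ I.ncard = Module.finrank (ZMod 2) C ∧
    ∀ v : I → ZMod 2, ∃ c ∈ C, ∀ i : I, c i = v i

/-- A set of check positions is the complement of an information set. -/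
def IsCheckPositions {ι : Type*} (C : BinaryCode ι) (J : Set ι) : Prop :=
  IsInformationSet C Jᶜ

/-! ## Reed-Muller codes as extended cyclic codes -/

/-- The `2`-weight of `k`: the sum of its binary digits. -/
def wt (k : ℕ) : ℕ := (Nat.digits 2 k).sum

section RM

variable (K : Type*) [Field K] [Fintype K] [Algebra (ZMod 2) K]

/-- The linear map `∑ a_g X^g ↦ ∑ a_g g^s` (with `0 ^ 0 = 1`), on the words indexed by the additive
group of `K`. -/
def phi (s : ℕ) : (K → ZMod 2) →ₗ[ZMod 2] K where
  toFun x := ∑ g : K, x g • g ^ s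
  map_add' x y := by simp [add_smul, Finset.sum_add_distrib]
  map_smul' c x := by simp [Finset.smul_sum, mul_smul]

/-- The Reed-Muller code `R(ρ, m)` of order `ρ` and length `2 ^ m` (where `K` has `2 ^ m` elements):
the code in the group algebra of `(K, +)` determined by the defining set
`{s | 0 ≤ s < 2 ^ m - 1, wt s < m - ρ}`. -/
def reedMuller (ρ m : ℕ) : BinaryCode K :=
  ⨅ s ∈ {s : ℕ | s < 2 ^ m - 1 ∧ wt s < m - ρ}, LinearMap.ker (phi K s)

variable {K}

/-- The punctured code at the position `0`, as a cyclic code of length `n`: the `i`-th coordinate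
is the coordinate at `α ^ i`, where `α` is a primitive `n`-th root of unity and `n = |K| - 1`. -/
def puncture {n : ℕ} (α : K) (C : BinaryCode K) : BinaryCode (ZMod n) :=
  C.map (LinearMap.funLeft (ZMod 2) (ZMod 2) (fun i : ZMod n => α ^ i.val))

/-- The defining set, with respect to `α`, of a cyclic code of length `n`: the exponents `e` such
that `∑ a_i (α ^ e) ^ i = 0` for every codeword `a`. -/
def cyclicDefiningSet {n : ℕ} [NeZero n] (α : K) (C : BinaryCode (ZMod n)) : Set (ZMod n) :=
  {e | ∀ c ∈ C, ∑ i : ZMod n, c i • (α ^ e.val) ^ i.val = 0}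

/-! ## Two-dimensional abelian codes -/

/-- The algebra `F₂[X, Y] / (X ^ r₁ - 1, Y ^ r₂ - 1)`, as the group algebra of
`ℤ / r₁ × ℤ / r₂`; an abelian code is an ideal of it. -/
abbrev AbelianAlgebra (r₁ r₂ : ℕ) := AddMonoidAlgebra (ZMod 2) (ZMod r₁ × ZMod r₂)

/-- The value `P(x, y)`, computed with the canonical exponents. -/
def evalAt {r₁ r₂ : ℕ} (P : AbelianAlgebra r₁ r₂) (x y : K) : K :=
  P.coeff.sum fun j c => c • (x ^ j.1.val * y ^ j.2.val)

/-- The defining set of an abelian code with respect to the roots of unity `β₁`, `β₂`. -/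
def abelianDefiningSet {r₁ r₂ : ℕ} (β₁ β₂ : K) (C : Ideal (AbelianAlgebra r₁ r₂)) :
    Set (ZMod r₁ × ZMod r₂) :=
  {e | ∀ P ∈ C, evalAt P (β₁ ^ e.1.val) (β₂ ^ e.2.val) = 0}

end RM

/-! ## The check-position construction -/

/-- The `2 ^ γ`-cyclotomic coset of `a` modulo `r`. -/
def cyclotomicCoset (γ r : ℕ) (a : ZMod r) : Set (ZMod r) :=
  {x | ∃ i : ℕ, x = a * 2 ^ (γ * i)}

/-- The `2`-orbit of `e` modulo `(r₁, r₂)`. -/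
def twoOrbit {r₁ r₂ : ℕ} (e : ZMod r₁ × ZMod r₂) : Set (ZMod r₁ × ZMod r₂) :=
  {x | ∃ i : ℕ, x = (e.1 * 2 ^ i, e.2 * 2 ^ i)}

/-- `R` is a set of restricted representatives of the `2`-orbits in `D`: it is a complete set of
representatives of the `2`-orbits in `D`, and its first projection is a complete set of
representatives of the `2`-cyclotomic cosets modulo `r₁` in the first projection of `D`. -/
def IsRestrictedReps {r₁ r₂ : ℕ} (R : Finset (ZMod r₁ × ZMod r₂))
    (D : Set (ZMod r₁ × ZMod r₂)) : Prop :=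
  (R : Set (ZMod r₁ × ZMod r₂)) ⊆ D ∧
  (∀ e ∈ D, ∃! d, d ∈ R ∧ twoOrbit d = twoOrbit e) ∧
  (∀ x ∈ Prod.fst '' D, ∃! y, y ∈ R.image Prod.fst ∧
    cyclotomicCoset 1 r₁ y = cyclotomicCoset 1 r₁ x)

section Construction

variable {r₁ r₂ : ℕ}

/-- `m(e₁) = |C_{r₁}(e₁)|`. -/
noncomputable def mFst (e₁ : ZMod r₁) : ℕ := (cyclotomicCoset 1 r₁ e₁).ncard

/-- `m(e₁, e₂) = |C_{2 ^ m(e₁), r₂}(e₂)|`. -/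
noncomputable def mPair (e : ZMod r₁ × ZMod r₂) : ℕ :=
  (cyclotomicCoset (mFst e.1) r₂ e.2).ncard

/-- `M(e₁)`, the sum of `m(e₁, e₂)` over all `e₂` with `(e₁, e₂) ∈ R`. -/
noncomputable def bigM (R : Finset (ZMod r₁ × ZMod r₂)) (e₁ : ZMod r₁) : ℕ :=
  ∑ d ∈ R with d.1 = e₁, mPair d

/-- The finite set of all values `M(e₁)`, for `e₁` in the first projection of `R`. -/
noncomputable def bigMValues (R : Finset (ZMod r₁ × ZMod r₂)) : Finset ℕ :=
  (R.image Prod.fst).image (bigM R)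

/-- The number `s` of distinct values `M(e₁)`. -/
noncomputable def sLen (R : Finset (ZMod r₁ × ZMod r₂)) : ℕ := (bigMValues R).card

/-- The sequence `f_1 > f_2 > ⋯ > f_s > 0 = f_{s + 1}`: `f_1` is the largest value of `M`, and
`f_i` is the largest value of `M` less than `f_{i - 1}`. The maximum of the empty set is `0`, and
the value at the index `0` is not used. -/
noncomputable def fSeq (R : Finset (ZMod r₁ × ZMod r₂)) : ℕ → ℕ
  | 0 => 0
  | 1 => (bigMValues R).sup id
  | i + 2 => ((bigMValues R).filter (· < fSeq R (i + 1))).sup id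

/-- `g_i`, the sum of `m(e₁)` over the `e₁` in the first projection of `R` with `M(e₁) ≥ f_i`. -/
noncomputable def gSeq (R : Finset (ZMod r₁ × ZMod r₂)) (i : ℕ) : ℕ :=
  ∑ e₁ ∈ R.image Prod.fst with fSeq R i ≤ bigM R e₁, mFst e₁

/-- The set `Γ` obtained from a set `R` of restricted representatives. -/
def gammaSet (R : Finset (ZMod r₁ × ZMod r₂)) : Set (ZMod r₁ × ZMod r₂) :=
  {i | ∃ j, 1 ≤ j ∧ j ≤ sLen R ∧ fSeq R (j + 1) ≤ i.2.val ∧ i.2.val < fSeq R j ∧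
    i.1.val < gSeq R j}

/-- The explicit union of two rectangles in `ℤ / r₁ × ℤ / r₂`. The divisions are exact. -/
def staircase (a b r₁ r₂ : ℕ) : Set (ZMod r₁ × ZMod r₂) :=
  {i | (i.1.val < a * (a - 1) / 2 ∧ i.2.val < b ^ 2) ∨
    (a * (a - 1) / 2 ≤ i.1.val ∧ i.1.val < a * (a + 1) / 2 ∧ i.2.val < b * (b + 1) / 2)}

end Construction

end ReedMullerInfo

/-!
Under `T` the characters of `ℤ / n` become evaluations of monomials at points of `K × K`, and a word
becomes a polynomial in two variables. The defining set of the punctured code `R*(m - 3, m)` is the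
set of the residues `2 ^ i + 2 ^ j` with `i, j < m` (`cyclicDefiningSet_puncture`). The parameters
and the check positions both come from the distribution of these residues over their reductions
modulo `r₁ = 2 ^ a - 1`.
The numbers `2 ^ i + 2 ^ j` with `i, j < m` lie in `[2, 2 ^ m]`, hence remain distinct modulo
`2 ^ m - 1`, so that they correspond to the unordered pairs `s(i, j)` (`pairPow_injOn_mod`), and
reduction modulo `r₁` reduces `i` and `j` modulo `a`. There are `b ^ 2` pairs over each of the
`a * (a - 1) / 2` pairs of distinct residues, and `b * (b + 1) / 2` over each of the `a` diagonal
ones (`card_filter_map_mod`).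

*Parameters.* For restricted representatives, `M(e₁)` is the number of elements of the defining set
over `e₁`, and the sum of `m(e₁)` over representatives counts points of the first projection
(`IsRestrictedReps.bigM_eq_fibreCard`, `IsRestrictedReps.sum_mFst_eq`). So the `f_i` and `g_i` are
read off from the count above. An abelian code with the given defining set exists because binary
words separate characters from sets of characters closed under the Frobenius map
(`exists_word_separating`).

*Check positions.* A word supported in the staircase and satisfying all the checks is a polynomial
with more zeros than its degrees allow, and vanishes (`eq_zero_of_staircase`). Since the staircase
has as many elements as there are checks, values outside it extend uniquely to a word over `K`
satisfying the checks; this word is binary because its square has the same property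
(`exists_binary_extension`).

*Reed-Muller codes.* The value at `0` is a parity check, which gives the information set of
`R(m - 3, m)`. The code `R(2, m)` is the dual of `R(m - 3, m)` (`mem_reedMuller_two_iff`): one
inclusion is the interpolation formula `eq_sum_add_sum_pow_mul`, the other one the nondegeneracy of
the trace form. Finally the complement of an information set is an information set of the dual code
(`IsInformationSet.dual`).
-/

namespace ReedMullerInfo

open Finset

/-! ### Binary weights -/

lemma wt_two_mul (k : ℕ) : wt (2 * k) = wt k := by
  rcases Nat.eq_zero_or_pos k with rfl | hk
  · simp
  · unfold wt
    rw [Nat.digits_def' (by norm_num) (by omega)]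
    simp

lemma wt_two_mul_add_one (k : ℕ) : wt (2 * k + 1) = wt k + 1 := by
  unfold wt
  rw [Nat.digits_def' (by norm_num) (by omega)]
  have h1 : (2 * k + 1) % 2 = 1 := by omega
  have h2 : (2 * k + 1) / 2 = k := by omega
  rw [h1, h2, List.sum_cons, add_comm]

@[simp] lemma wt_zero : wt 0 = 0 := by simp [wt]

lemma wt_two_pow (k : ℕ) : wt (2 ^ k) = 1 := by
  induction k with
  | zero => simp [wt]
  | succ k ih => rw [pow_succ', wt_two_mul, ih]

lemma wt_add_le (x y : ℕ) : wt (x + y) ≤ wt x + wt y := by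
  induction x using Nat.strong_induction_on generalizing y with
  | _ x ih =>
  rcases Nat.eq_zero_or_pos x with rfl | hx
  · simp
  obtain ⟨u, hu | hu⟩ := Nat.even_or_odd' x <;> obtain ⟨v, hv | hv⟩ := Nat.even_or_odd' y
  · have := ih u (by omega) v
    rw [hu, hv, ← mul_add, wt_two_mul, wt_two_mul, wt_two_mul]; exact this
  · have := ih u (by omega) v
    rw [hu, hv, ← add_assoc, ← mul_add, wt_two_mul_add_one, wt_two_mul, wt_two_mul_add_one]; omega
  · have := ih u (by omega) v
    rw [hu, hv, show 2 * u + 1 + 2 * v = 2 * (u + v) + 1 by ring, wt_two_mul_add_one, wt_two_mul,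
      wt_two_mul_add_one]; omega
  · rw [hu, hv, show 2 * u + 1 + (2 * v + 1) = 2 * (u + (v + 1)) by ring, wt_two_mul,
      wt_two_mul_add_one, wt_two_mul_add_one]
    have h1 : wt (v + 1) ≤ wt v + 1 := by
      rcases Nat.eq_zero_or_pos u with rfl | hu0
      · -- here `x = 1`, and the bound for `1 + v` is the induction on the second summand
        clear ih hv hu
        induction v using Nat.strong_induction_on with
        | _ v ihv =>
        obtain ⟨w, hw | hw⟩ := Nat.even_or_odd' v
        · rw [hw, wt_two_mul_add_one, wt_two_mul]
        · have := ihv w (by omega)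
          rw [hw, show 2 * w + 1 + 1 = 2 * (w + 1) by ring, wt_two_mul, wt_two_mul_add_one]; omega
      · have := ih 1 (by omega) v
        rwa [add_comm, show wt 1 = 1 from wt_two_pow 0, add_comm (1 : ℕ) (wt v)] at this
    have h2 := ih u (by omega) (v + 1)
    omega

lemma wt_eq_zero {k : ℕ} (h : wt k = 0) : k = 0 := by
  induction k using Nat.strong_induction_on with
  | _ k ih =>
  obtain ⟨u, hu | hu⟩ := Nat.even_or_odd' k
  · rw [hu, wt_two_mul] at h
    by_contra h0
    have := ih u (by omega) h
    omega
  · rw [hu, wt_two_mul_add_one] at h; omega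

lemma eq_two_pow_of_wt_eq_one {k : ℕ} (h : wt k = 1) : ∃ i, k = 2 ^ i := by
  induction k using Nat.strong_induction_on with
  | _ k ih =>
  obtain ⟨u, hu | hu⟩ := Nat.even_or_odd' k
  · rw [hu, wt_two_mul] at h
    have h0 : u ≠ 0 := by rintro rfl; simp at h
    obtain ⟨i, hi⟩ := ih u (by omega) h
    exact ⟨i + 1, by rw [hu, hi, pow_succ']⟩
  · rw [hu, wt_two_mul_add_one] at h
    have := wt_eq_zero (k := u) (by omega)
    exact ⟨0, by rw [hu, this]; rfl⟩

lemma eq_two_pow_add_of_wt_eq_two {k : ℕ} (h : wt k = 2) : ∃ i j, k = 2 ^ i + 2 ^ j := by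
  induction k using Nat.strong_induction_on with
  | _ k ih =>
  obtain ⟨u, hu | hu⟩ := Nat.even_or_odd' k
  · rw [hu, wt_two_mul] at h
    have h0 : u ≠ 0 := by rintro rfl; simp at h
    obtain ⟨i, j, hi⟩ := ih u (by omega) h
    exact ⟨i + 1, j + 1, by rw [hu, hi]; ring⟩
  · rw [hu, wt_two_mul_add_one] at h
    obtain ⟨i, hi⟩ := eq_two_pow_of_wt_eq_one (k := u) (by omega)
    exact ⟨i + 1, 0, by rw [hu, hi]; ring⟩

/-- Subtracting from `2 ^ m - 1` complements the `m` binary digits. -/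
lemma wt_add_wt_eq {m x y : ℕ} (h : x + y = 2 ^ m - 1) : wt x + wt y = m := by
  induction m generalizing x y with
  | zero =>
    simp at h
    simp [h.1, h.2]
  | succ m ih =>
    have h2 : 1 ≤ 2 ^ m := Nat.one_le_two_pow
    rw [pow_succ'] at h
    obtain ⟨u, hu | hu⟩ := Nat.even_or_odd' x <;> obtain ⟨v, hv | hv⟩ := Nat.even_or_odd' y
    · omega
    · have := ih (x := u) (y := v) (by omega)
      rw [hu, hv, wt_two_mul, wt_two_mul_add_one]; omega
    · have := ih (x := u) (y := v) (by omega)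
      rw [hu, hv, wt_two_mul, wt_two_mul_add_one]; omega
    · omega

lemma wt_two_pow_sub_one (m : ℕ) : wt (2 ^ m - 1) = m := by
  simpa using wt_add_wt_eq (m := m) (x := 2 ^ m - 1) (y := 0) (by simp)

/-! ### Exponents that are sums of two powers of two -/

/-- The number `2 ^ i + 2 ^ j` attached to the unordered pair `s(i, j)`. -/
def pairPow : Sym2 ℕ → ℕ :=
  Sym2.lift ⟨fun i j => 2 ^ i + 2 ^ j, fun _ _ => add_comm _ _⟩

@[simp] lemma pairPow_mk (i j : ℕ) : pairPow s(i, j) = 2 ^ i + 2 ^ j := rfl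

lemma two_pow_add_inj {i j k l : ℕ} (hij : i ≤ j) (hkl : k ≤ l)
    (h : 2 ^ i + 2 ^ j = 2 ^ k + 2 ^ l) : i = k ∧ j = l := by
  induction i generalizing j k l with
  | zero =>
    rcases Nat.eq_zero_or_pos k with rfl | hk
    · refine ⟨rfl, Nat.pow_right_injective le_rfl ?_⟩
      simpa using h
    · obtain ⟨k, rfl⟩ := Nat.exists_eq_succ_of_ne_zero hk.ne'
      obtain ⟨l, rfl⟩ := Nat.exists_eq_succ_of_ne_zero (show l ≠ 0 by omega)
      have h2 : 1 ≤ 2 ^ k := Nat.one_le_two_pow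
      have h3 : 1 ≤ 2 ^ l := Nat.one_le_two_pow
      rcases Nat.eq_zero_or_pos j with rfl | hj
      · simp only [pow_succ', pow_zero] at h; omega
      · obtain ⟨j, rfl⟩ := Nat.exists_eq_succ_of_ne_zero hj.ne'
        simp only [pow_succ', pow_zero] at h; omega
  | succ i ih =>
    obtain ⟨j, rfl⟩ := Nat.exists_eq_succ_of_ne_zero (show j ≠ 0 by omega)
    have h2 : 1 ≤ 2 ^ i := Nat.one_le_two_pow
    have h3 : 1 ≤ 2 ^ j := Nat.one_le_two_pow
    rcases Nat.eq_zero_or_pos k with rfl | hk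
    · rcases Nat.eq_zero_or_pos l with rfl | hl
      · simp only [pow_succ', pow_zero] at h; omega
      · obtain ⟨l, rfl⟩ := Nat.exists_eq_succ_of_ne_zero hl.ne'
        simp only [pow_succ', pow_zero] at h; omega
    · obtain ⟨k, rfl⟩ := Nat.exists_eq_succ_of_ne_zero hk.ne'
      obtain ⟨l, rfl⟩ := Nat.exists_eq_succ_of_ne_zero (show l ≠ 0 by omega)
      have := ih (j := j) (k := k) (l := l) (by omega) (by omega)
        (by simp only [pow_succ'] at h; omega)
      omega

lemma pairPow_injective : Function.Injective pairPow := by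
  intro z w
  induction z with | _ i j
  induction w with | _ k l
  wlog hij : i ≤ j generalizing i j
  · rw [Sym2.eq_swap (a := i)]; exact this j i (by omega)
  wlog hkl : k ≤ l generalizing k l
  · rw [Sym2.eq_swap (a := k)]; exact this l k (by omega)
  intro h
  obtain ⟨rfl, rfl⟩ := two_pow_add_inj hij hkl h
  rfl

lemma two_le_pairPow (z : Sym2 ℕ) : 2 ≤ pairPow z := by
  induction z with | _ i j
  have h2 : 1 ≤ 2 ^ i := Nat.one_le_two_pow
  have h3 : 1 ≤ 2 ^ j := Nat.one_le_two_pow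
  rw [pairPow_mk]; omega

lemma pairPow_le {m : ℕ} {z : Sym2 ℕ} (hz : z ∈ (range m).sym2) : pairPow z ≤ 2 ^ m := by
  induction z with | _ i j
  rw [Finset.mk_mem_sym2_iff, mem_range, mem_range] at hz
  obtain ⟨m, rfl⟩ := Nat.exists_eq_succ_of_ne_zero (show m ≠ 0 by omega)
  have h2 : 2 ^ i ≤ 2 ^ m := Nat.pow_le_pow_right (by norm_num) (by omega)
  have h3 : 2 ^ j ≤ 2 ^ m := Nat.pow_le_pow_right (by norm_num) (by omega)
  rw [pairPow_mk, pow_succ']; omega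

/-- The numbers `2 ^ i + 2 ^ j` with `i, j < m` lie in the interval `[2, 2 ^ m]`, which is a
complete residue system modulo `2 ^ m - 1`, so that they remain distinct modulo `2 ^ m - 1`. -/
lemma pairPow_injOn_mod {m : ℕ} :
    Set.InjOn (fun z => (pairPow z : ZMod (2 ^ m - 1))) ((range m).sym2 : Set (Sym2 ℕ)) := by
  intro z hz w hw h
  have hz1 := pairPow_le hz
  have hw1 := pairPow_le hw
  have hz2 := two_le_pairPow z
  have hw2 := two_le_pairPow w
  apply pairPow_injective
  simp only [ZMod.natCast_eq_natCast_iff] at h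
  have h' : pairPow z - 2 ≡ pairPow w - 2 [MOD 2 ^ m - 1] := by
    apply Nat.ModEq.add_right_cancel' 2
    rwa [Nat.sub_add_cancel hz2, Nat.sub_add_cancel hw2]
  have := Nat.ModEq.eq_of_lt_of_lt h' (by omega) (by omega)
  omega

/-- Modulo `2 ^ a - 1` the exponents of the powers of two matter modulo `a` only. -/
lemma pairPow_map_mod (a : ℕ) (z : Sym2 ℕ) :
    (pairPow (z.map (· % a)) : ZMod (2 ^ a - 1)) = pairPow z := by
  have h1 : (2 : ZMod (2 ^ a - 1)) ^ a = 1 := by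
    have : ((2 ^ a - 1 + 1 : ℕ) : ZMod (2 ^ a - 1)) = 1 := by
      rw [Nat.cast_add, ZMod.natCast_self]; simp
    rw [Nat.sub_add_cancel Nat.one_le_two_pow] at this
    exact_mod_cast this
  have h2 (i : ℕ) : (2 : ZMod (2 ^ a - 1)) ^ (i % a) = 2 ^ i := by
    conv_rhs => rw [← Nat.mod_add_div i a, pow_add, pow_mul, h1, one_pow, mul_one]
  induction z with | _ i j
  simp [h2]

/-! ### Power sums over a finite field of characteristic two -/

section PowerSums

variable {K : Type*} [Field K] [Fintype K]

lemma sum_pow_eq_zero_of_not_dvd {k : ℕ} (h : ¬ Fintype.card K - 1 ∣ k) :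
    ∑ g : K, g ^ k = 0 := by
  classical
  have hk : k ≠ 0 := by rintro rfl; exact h (dvd_zero _)
  have h1 := FiniteField.sum_pow_units K k
  rw [if_neg h] at h1
  rw [← Finset.sum_erase (f := fun g : K => g ^ k) univ (a := (0 : K)) (zero_pow hk)]
  refine Eq.trans (Eq.symm ?_) h1
  refine Finset.sum_bij (fun u _ => (u : K)) (by simp) (fun u _ v _ h => Units.ext h) ?_ (by simp)
  intro g hg
  exact ⟨Units.mk0 g (by simpa using hg), by simp, rfl⟩

variable {m : ℕ}

/-- The sum of `g ^ s * g ^ (2 ^ i + 2 ^ j)` over the field vanishes when the `2`-weight of `s` is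
less than `m - 2`: the two positive multiples of `2 ^ m - 1` in the range of the exponent have
`2`-weight `m`. -/
lemma sum_pow_mul_pow_pairPow (hK : Fintype.card K = 2 ^ m) {s : ℕ} (hs : s < 2 ^ m - 1)
    (hws : wt s < m - 2) {z : Sym2 ℕ} (hz : z ∈ (range m).sym2) :
    ∑ g : K, g ^ s * g ^ pairPow z = 0 := by
  simp_rw [← pow_add]
  apply sum_pow_eq_zero_of_not_dvd
  rw [hK]
  rintro ⟨t, ht⟩
  have hz1 := pairPow_le hz
  have hz2 := two_le_pairPow z
  have hw : wt (s + pairPow z) < m := by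
    induction z with | _ i j
    have h1 := wt_add_le s (2 ^ i + 2 ^ j)
    have h2 := wt_add_le (2 ^ i) (2 ^ j)
    rw [wt_two_pow, wt_two_pow] at h2
    rw [pairPow_mk]; omega
  have ht2 : t = 1 ∨ t = 2 := by
    have h0 : t ≠ 0 := by rintro rfl; omega
    have h3 : t < 3 := by
      by_contra h3
      have : (2 ^ m - 1) * 3 ≤ (2 ^ m - 1) * t := Nat.mul_le_mul_left _ (by omega)
      omega
    omega
  rcases ht2 with rfl | rfl
  · rw [ht, mul_one, wt_two_pow_sub_one] at hw; omega
  · rw [ht, mul_comm, wt_two_mul, wt_two_pow_sub_one] at hw; omega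

lemma two_pow_lt_two_pow_sub_one {m i j : ℕ} (hm : 3 ≤ m) (hi : i < m) (hj : j < m) (hij : i ≠ j) :
    2 ^ i + 2 ^ j < 2 ^ m - 1 := by
  wlog h : i < j generalizing i j
  · rw [add_comm]; exact this hj hi hij.symm (by omega)
  obtain ⟨m, rfl⟩ := Nat.exists_eq_add_of_le' hm
  have h2 : 2 ^ i ≤ 2 ^ (m + 1) := Nat.pow_le_pow_right (by norm_num) (by omega)
  have h3 : 2 ^ j ≤ 2 ^ (m + 2) := Nat.pow_le_pow_right (by norm_num) (by omega)
  have h4 : 1 ≤ 2 ^ m := Nat.one_le_two_pow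
  have : 2 ^ (m + 1) = 2 * 2 ^ m := by ring
  have : 2 ^ (m + 2) = 4 * 2 ^ m := by ring
  have : 2 ^ (m + 3) = 8 * 2 ^ m := by ring
  omega

/-- Every power function `g ↦ g ^ s` with `s` of `2`-weight `1` or `2` is `g ↦ g ^ (2 ^ i + 2 ^ j)`
with `i, j < m`; when the weight is `1`, `i = j` is one less than the exponent of `2` in `s`,
cyclically. -/
lemma exists_pow_eq_pow_pairPow (hK : Fintype.card K = 2 ^ m) (hm : 0 < m) {s : ℕ}
    (hs0 : 0 < s) (hs : s < 2 ^ m - 1) (hws : wt s < 3) :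
    ∃ z ∈ (range m).sym2, ∀ g : K, g ^ s = g ^ pairPow z := by
  have h0 : wt s ≠ 0 := fun h => by rw [wt_eq_zero h] at hs0; omega
  have hlt {i : ℕ} (hi : 2 ^ i ≤ s) : i < m :=
    (Nat.pow_lt_pow_iff_right (a := 2) (by norm_num)).1 (by omega)
  obtain h1 | h2 : wt s = 1 ∨ wt s = 2 := by omega
  · obtain ⟨i, rfl⟩ := eq_two_pow_of_wt_eq_one h1
    have hi := hlt le_rfl
    rcases Nat.eq_zero_or_pos i with rfl | hi0
    · refine ⟨s(m - 1, m - 1), by simpa using hm, fun g => ?_⟩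
      rw [pairPow_mk, ← two_mul, ← pow_succ', Nat.sub_add_cancel hm, ← hK, FiniteField.pow_card]
      simp
    · refine ⟨s(i - 1, i - 1), by simp; omega, fun g => ?_⟩
      rw [pairPow_mk, ← two_mul, ← pow_succ', Nat.sub_add_cancel hi0]
  · obtain ⟨i, j, rfl⟩ := eq_two_pow_add_of_wt_eq_two h2
    refine ⟨s(i, j), ?_, fun g => rfl⟩
    rw [Finset.mk_mem_sym2_iff, mem_range, mem_range]
    exact ⟨hlt (Nat.le_add_right _ _), hlt (Nat.le_add_left _ _)⟩

lemma exists_pow_pairPow_eq_pow (hK : Fintype.card K = 2 ^ m) (hm : 3 ≤ m) {z : Sym2 ℕ}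
    (hz : z ∈ (range m).sym2) :
    ∃ s, 0 < s ∧ s < 2 ^ m - 1 ∧ wt s < 3 ∧ ∀ g : K, g ^ pairPow z = g ^ s := by
  induction z with | _ i j
  rw [Finset.mk_mem_sym2_iff, mem_range, mem_range] at hz
  by_cases hij : i = j
  · subst hij
    rw [pairPow_mk, ← two_mul, ← pow_succ']
    by_cases hi : i + 1 = m
    · refine ⟨1, one_pos, ?_, by rw [show wt 1 = 1 from wt_two_pow 0]; norm_num, fun g => ?_⟩
      · have : 2 ^ 3 ≤ 2 ^ m := Nat.pow_le_pow_right (by norm_num) hm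
        omega
      · rw [hi, ← hK, FiniteField.pow_card, pow_one]
    · refine ⟨2 ^ (i + 1), by positivity, ?_, by rw [wt_two_pow]; norm_num, fun g => rfl⟩
      have := two_pow_lt_two_pow_sub_one (m := m) (i := 0) (j := i + 1) hm (by omega) (by omega)
        (by omega)
      omega
  · refine ⟨2 ^ i + 2 ^ j, by positivity, two_pow_lt_two_pow_sub_one hm hz.1 hz.2 hij, ?_,
      fun g => rfl⟩
    have := wt_add_le (2 ^ i) (2 ^ j)
    rw [wt_two_pow, wt_two_pow] at this
    omega

/-- Every power function `g ↦ g ^ (2 ^ i + 2 ^ j)` with `i, j < m` is the square of another one,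
since `i` and `j` may be decreased cyclically. -/
lemma exists_sq_pairPow {z : Sym2 ℕ} (hz : z ∈ (range m).sym2) :
    ∃ z' ∈ (range m).sym2, ∀ {M : Type _} [CommMonoid M] (g : M), g ^ 2 ^ m = g →
      g ^ pairPow z = (g ^ pairPow z') ^ 2 := by
  have key (i : ℕ) (hi : i < m) : ∃ i' < m, ∀ {M : Type _} [CommMonoid M] (g : M),
      g ^ 2 ^ m = g → g ^ 2 ^ i = (g ^ 2 ^ i') ^ 2 := by
    rcases Nat.eq_zero_or_pos i with rfl | hi0
    · refine ⟨m - 1, by omega, fun g hg => ?_⟩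
      rw [← pow_mul, ← pow_succ, Nat.sub_add_cancel hi, hg, pow_zero, pow_one]
    · refine ⟨i - 1, by omega, fun g hg => ?_⟩
      rw [← pow_mul, ← pow_succ, Nat.sub_add_cancel hi0]
  induction z with | _ i j
  rw [Finset.mk_mem_sym2_iff, mem_range, mem_range] at hz
  obtain ⟨i', hi', hi⟩ := key i hz.1
  obtain ⟨j', hj', hj⟩ := key j hz.2
  refine ⟨s(i', j'), by simp [hi', hj'], fun g hg => ?_⟩
  rw [pairPow_mk, pairPow_mk, pow_add, pow_add, mul_pow, hi g hg, hj g hg]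

lemma exists_pow_two_pow_pairPow (hK : Fintype.card K = 2 ^ m) {z : Sym2 ℕ}
    (hz : z ∈ (range m).sym2) (k : ℕ) :
    ∃ z' ∈ (range m).sym2, ∀ g : K, g ^ pairPow z = (g ^ pairPow z') ^ 2 ^ k := by
  induction k with
  | zero => exact ⟨z, hz, by simp⟩
  | succ k ih =>
    obtain ⟨w, hw, h1⟩ := ih
    obtain ⟨w', hw', h2⟩ := exists_sq_pairPow hw
    refine ⟨w', hw', fun g => ?_⟩
    rw [h1, h2 g (by rw [← hK, FiniteField.pow_card]), ← pow_mul, ← pow_succ']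

/-- The interpolation formula over a finite field of characteristic two, which expresses the
coefficients of the polynomial function `f` by power sums of its values. It rests on
`1 + ∑ g ^ k * h ^ (q - 1 - k) = 1 - (g - h) ^ (q - 1)`. -/
lemma eq_sum_add_sum_pow_mul [CharP K 2] (f : K → K) (g : K) :
    f g = ∑ h, f h + ∑ k ∈ range (Fintype.card K),
      g ^ k * ∑ h, f h * h ^ (Fintype.card K - 1 - k) := by
  classical
  set q := Fintype.card K
  have hS (h : K) : 1 + ∑ k ∈ range q, g ^ k * h ^ (q - 1 - k) = if h = g then 1 else 0 := by
    split_ifs with hg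
    · subst hg
      have : ∀ k ∈ range q, h ^ k * h ^ (q - 1 - k) = h ^ (q - 1) := by
        intro k hk
        rw [mem_range] at hk
        rw [← pow_add]; congr 1; omega
      rw [Finset.sum_congr rfl this]
      simp [q]
    · have h1 := (Commute.all g h).geom_sum₂_mul q
      rw [FiniteField.pow_card, FiniteField.pow_card] at h1
      rw [mul_eq_right₀ (sub_ne_zero.2 (Ne.symm hg))] at h1
      rw [h1, CharTwo.add_self_eq_zero]
  simp_rw [Finset.mul_sum]
  rw [Finset.sum_comm, ← Finset.sum_add_distrib]
  have (h : K) : f h + ∑ k ∈ range q, g ^ k * (f h * h ^ (q - 1 - k)) =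
      if h = g then f h else 0 := by
    simp_rw [mul_left_comm _ (f h)]
    rw [← Finset.mul_sum, ← mul_one_add, hS, mul_ite, mul_one, mul_zero]
  simp [this]

end PowerSums

/-! ### Information sets and duality -/

/-- An information set is a set of coordinates on which the restriction of the code is
bijective. -/
lemma isInformationSet_iff {ι : Type*} [Finite ι] (C : BinaryCode ι) (I : Set ι) :
    IsInformationSet C I ↔ (∀ c ∈ C, (∀ i ∈ I, c i = 0) → c = 0) ∧
      ∀ v : ι → ZMod 2, ∃ c ∈ C, ∀ i ∈ I, c i = v i := by
  classical
  have := Fintype.ofFinite ι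
  let L : C →ₗ[ZMod 2] (I → ZMod 2) :=
    (LinearMap.funLeft (ZMod 2) (ZMod 2) ((↑) : I → ι)).comp C.subtype
  have hcard : Module.finrank (ZMod 2) (I → ZMod 2) = I.ncard := by
    rw [Module.finrank_fintype_fun_eq_card, ← Nat.card_eq_fintype_card, Nat.card_coe_set_eq]
  have hinj : Function.Injective L ↔ ∀ c ∈ C, (∀ i ∈ I, c i = 0) → c = 0 := by
    rw [injective_iff_map_eq_zero]
    refine ⟨fun h c hc h0 => ?_, fun h c h0 => ?_⟩
    · exact congrArg Subtype.val (h ⟨c, hc⟩ (funext fun i => h0 i i.2))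
    · exact Subtype.ext (h c c.2 fun i hi => congrFun h0 ⟨i, hi⟩)
  have hsurj : Function.Surjective L ↔ ∀ v : ι → ZMod 2, ∃ c ∈ C, ∀ i ∈ I, c i = v i := by
    refine ⟨fun h v => ?_, fun h v => ?_⟩
    · obtain ⟨c, hc⟩ := h (fun i => v i)
      exact ⟨c, c.2, fun i hi => congrFun hc ⟨i, hi⟩⟩
    · obtain ⟨c, hc, hv⟩ := h (fun i => if hi : i ∈ I then v ⟨i, hi⟩ else 0)
      refine ⟨⟨c, hc⟩, funext fun i => ?_⟩
      have := hv i i.2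
      rw [dif_pos i.2] at this
      exact this
  rw [← hinj, ← hsurj]
  constructor
  · rintro ⟨-, h1, h2⟩
    have hs : Function.Surjective L := fun v => by
      obtain ⟨c, hc, hv⟩ := h2 v
      exact ⟨⟨c, hc⟩, funext hv⟩
    refine ⟨?_, hs⟩
    rwa [LinearMap.injective_iff_surjective_of_finrank_eq_finrank (by rw [hcard, h1])]
  · rintro ⟨h1, h2⟩
    refine ⟨Set.toFinite _, ?_, fun v => ?_⟩
    · rw [← hcard]
      exact (LinearEquiv.finrank_eq (LinearEquiv.ofBijective L ⟨h1, h2⟩)).symm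
    · obtain ⟨c, hc⟩ := h2 v
      exact ⟨c, c.2, congrFun hc⟩

/-- The complement of an information set is an information set of the dual code. -/
lemma IsInformationSet.dual {ι : Type*} [Fintype ι] {C C' : BinaryCode ι} {I : Set ι}
    (h : IsInformationSet C I) (hdual : ∀ x, x ∈ C' ↔ ∀ c ∈ C, ∑ i, x i * c i = 0) :
    IsInformationSet C' Iᶜ := by
  classical
  rw [isInformationSet_iff] at h ⊢
  obtain ⟨hinj, hsurj⟩ := h
  -- `e g` is the codeword of `C` whose restriction to `I` is the unit vector at `g`
  choose e he hei using fun g : ι => hsurj (Pi.single g 1)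
  have hsum (x : ι → ZMod 2) (g : ι) (hg : g ∈ I) :
      ∑ i, x i * e g i = x g + ∑ i with i ∉ I, x i * e g i := by
    rw [← Finset.sum_filter_add_sum_filter_not univ (· ∈ I)]
    congr 1
    rw [Finset.sum_eq_single_of_mem g (by simpa using hg)]
    · rw [hei g g hg]; simp
    · intro j hj hjg
      rw [hei g j (by simpa using hj)]; simp [hjg]
  constructor
  · intro x hx h0
    funext g
    by_cases hg : g ∈ I
    · have h1 := (hdual x).1 hx (e g) (he g)
      rw [hsum x g hg, Finset.sum_eq_zero, add_zero] at h1
      · exact h1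
      · intro i hi
        rw [h0 i (by simpa using hi), zero_mul]
    · exact h0 g hg
  · intro v
    refine ⟨fun g => if g ∈ I then - ∑ i with i ∉ I, v i * e g i else v g, ?_, fun i hi => if_neg hi⟩
    rw [hdual]
    intro c hc
    -- `c` is the combination of the words `e g` given by its entries in `I`
    have hexp : c = ∑ g with g ∈ I, c g • e g := by
      rw [← sub_eq_zero]
      apply hinj _ (C.sub_mem hc (C.sum_mem fun g _ => C.smul_mem _ (he g)))
      intro i hi
      rw [Pi.sub_apply, Finset.sum_apply, Finset.sum_eq_single_of_mem i (by simpa using hi)]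
      · rw [Pi.smul_apply, hei i i hi]; simp
      · intro j _ hji
        rw [Pi.smul_apply, hei j i hi]; simp [hji.symm]
    rw [hexp]
    simp only [Finset.sum_apply, Pi.smul_apply, Finset.mul_sum]
    rw [Finset.sum_comm]
    apply Finset.sum_eq_zero
    intro g hg
    have hg' : g ∈ I := by simpa using hg
    simp_rw [smul_eq_mul, mul_left_comm _ (c g)]
    rw [← Finset.mul_sum, hsum _ g hg', if_pos hg', neg_add_eq_zero.2, mul_zero]
    refine Finset.sum_congr rfl fun i hi => ?_
    rw [if_neg (by simpa using hi)]

/-! ### The Reed-Muller codes of orders `m - 3` and `2` -/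

section RM

variable {K : Type*} [Field K] [Fintype K] [Algebra (ZMod 2) K] {m : ℕ}

lemma charP_two_of_algebra (K : Type*) [Field K] [Algebra (ZMod 2) K] : CharP K 2 :=
  charP_of_injective_algebraMap (algebraMap (ZMod 2) K).injective 2

lemma mem_reedMuller {ρ : ℕ} {x : K → ZMod 2} :
    x ∈ reedMuller K ρ m ↔ ∀ s, s < 2 ^ m - 1 → wt s < m - ρ → ∑ g : K, x g • g ^ s = 0 := by
  simp [reedMuller, Submodule.mem_iInf, phi]

lemma sum_smul_one_eq_zero {ι : Type*} [Fintype ι] {x : ι → ZMod 2} :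
    ∑ g, x g • (1 : K) = 0 ↔ ∑ g, x g = 0 := by
  rw [← Finset.sum_smul, smul_eq_zero]
  simp

lemma mem_reedMuller_sub_three (hK : Fintype.card K = 2 ^ m) (hm : 3 ≤ m) {x : K → ZMod 2} :
    x ∈ reedMuller K (m - 3) m ↔
      ∑ g, x g = 0 ∧ ∀ z ∈ (range m).sym2, ∑ g : K, x g • g ^ pairPow z = 0 := by
  rw [mem_reedMuller, show m - (m - 3) = 3 by omega]
  have hpos : 0 < 2 ^ m - 1 := by
    have : 2 ^ 3 ≤ 2 ^ m := Nat.pow_le_pow_right (by norm_num) hm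
    omega
  constructor
  · intro h
    refine ⟨?_, fun z hz => ?_⟩
    · have := h 0 hpos (by simp)
      simp_rw [pow_zero] at this
      exact sum_smul_one_eq_zero.1 this
    · obtain ⟨s, -, hs, hw, he⟩ := exists_pow_pairPow_eq_pow hK hm hz
      simp_rw [he]
      exact h s hs hw
  · rintro ⟨h0, h⟩ s hs hw
    rcases Nat.eq_zero_or_pos s with rfl | hs0
    · simp_rw [pow_zero]
      exact sum_smul_one_eq_zero.2 h0
    · obtain ⟨z, hz, he⟩ := exists_pow_eq_pow_pairPow hK (by omega) hs0 hs hw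
      simp_rw [he]
      exact h z hz

lemma reedMuller_two_orthogonal (hK : Fintype.card K = 2 ^ m) (hm : 3 ≤ m) {x c : K → ZMod 2}
    (hx : x ∈ reedMuller K 2 m) (hc : c ∈ reedMuller K (m - 3) m) : ∑ g, x g * c g = 0 := by
  have := charP_two_of_algebra K
  rw [mem_reedMuller] at hx hc
  rw [show m - (m - 3) = 3 by omega] at hc
  have hpos : 0 < 2 ^ m - 1 := by
    have : 2 ^ 3 ≤ 2 ^ m := Nat.pow_le_pow_right (by norm_num) hm
    omega
  have hc0 : ∑ g : K, algebraMap (ZMod 2) K (c g) = 0 := by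
    have := hc 0 hpos (by simp)
    simpa [Algebra.smul_def] using this
  apply (algebraMap (ZMod 2) K).injective
  rw [map_sum, map_zero]
  simp_rw [map_mul]
  rw [Finset.sum_congr rfl fun g _ => congrArg (· * algebraMap (ZMod 2) K (c g))
    (eq_sum_add_sum_pow_mul (fun g => algebraMap (ZMod 2) K (x g)) g)]
  simp_rw [add_mul, Finset.sum_mul (range _)]
  rw [Finset.sum_add_distrib, ← Finset.mul_sum, hc0, mul_zero, zero_add, Finset.sum_comm]
  apply Finset.sum_eq_zero
  intro k hk
  rw [mem_range, hK] at hk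
  simp_rw [mul_right_comm _ _ (algebraMap (ZMod 2) K (c _))]
  rw [← Finset.sum_mul, hK, mul_eq_zero]
  by_cases hk1 : k < 2 ^ m - 1 ∧ wt k < 3
  · left
    have := hc k hk1.1 hk1.2
    simpa [Algebra.smul_def, mul_comm] using this
  · -- complementing the binary digits turns `3 ≤ wt k` into `wt (2 ^ m - 1 - k) < m - 2`
    right
    have hw := wt_add_wt_eq (m := m) (x := k) (y := 2 ^ m - 1 - k) (by omega)
    have hk0 : k ≠ 0 := by
      rintro rfl
      exact hk1 ⟨hpos, by simp⟩
    have hk3 : 3 ≤ wt k := by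
      by_contra h3
      have hk2 : k = 2 ^ m - 1 := by
        by_contra hne
        exact hk1 ⟨by omega, by omega⟩
      rw [hk2, wt_two_pow_sub_one] at h3
      omega
    have := hx (2 ^ m - 1 - k) (by omega) (by omega)
    simpa [Algebra.smul_def] using this

/-- The words `g ↦ Tr (l * g ^ s)` with `wt s < m - 2` belong to the Reed-Muller code of order
`m - 3`. -/
lemma trace_mul_pow_mem_reedMuller (hK : Fintype.card K = 2 ^ m) (hm : 3 ≤ m) {s : ℕ}
    (hs : s < 2 ^ m - 1) (hws : wt s < m - 2) (l : K) :
    (fun g : K => Algebra.trace (ZMod 2) K (l * g ^ s)) ∈ reedMuller K (m - 3) m := by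
  have := charP_two_of_algebra K
  have htr (y : K) : algebraMap (ZMod 2) K (Algebra.trace (ZMod 2) K y) =
      ∑ i ∈ range (Module.finrank (ZMod 2) K), y ^ 2 ^ i := by
    rw [FiniteField.algebraMap_trace_eq_sum_pow]
    simp
  rw [mem_reedMuller_sub_three hK hm]
  constructor
  · apply (algebraMap (ZMod 2) K).injective
    rw [map_sum, map_zero]
    simp_rw [htr]
    rw [Finset.sum_comm]
    apply Finset.sum_eq_zero
    intro i _
    rw [← sum_pow_char_pow, ← Finset.mul_sum,
      FiniteField.sum_pow_lt_card_sub_one K s (by rw [hK]; exact hs), mul_zero,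
      zero_pow (by positivity)]
  · intro z hz
    simp_rw [Algebra.smul_def, htr, Finset.sum_mul]
    rw [Finset.sum_comm]
    apply Finset.sum_eq_zero
    intro i _
    obtain ⟨w, hw, h⟩ := exists_pow_two_pow_pairPow hK hz i
    simp_rw [h, ← mul_pow]
    rw [← sum_pow_char_pow]
    simp_rw [mul_assoc]
    rw [← Finset.mul_sum, sum_pow_mul_pow_pairPow hK hs hws hw, mul_zero,
      zero_pow (by positivity)]

/-- The Reed-Muller code of order `2` is the dual of the one of order `m - 3`. -/
lemma mem_reedMuller_two_iff (hK : Fintype.card K = 2 ^ m) (hm : 3 ≤ m) (x : K → ZMod 2) :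
    x ∈ reedMuller K 2 m ↔ ∀ c ∈ reedMuller K (m - 3) m, ∑ g, x g * c g = 0 := by
  refine ⟨fun hx c hc => reedMuller_two_orthogonal hK hm hx hc, fun h => ?_⟩
  rw [mem_reedMuller]
  intro s hs hws
  apply (traceForm_nondegenerate (ZMod 2) K).1
  intro l
  have := h _ (trace_mul_pow_mem_reedMuller hK hm hs hws l)
  rw [Algebra.traceForm_apply, mul_comm, Finset.mul_sum, map_sum, ← this]
  refine Finset.sum_congr rfl fun g _ => ?_
  rw [mul_smul_comm, map_smul, smul_eq_mul]

end RM

/-! ### Characters and binary words -/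

section Characters

variable {K : Type*} [Field K]

lemma pow_val_natCast {n : ℕ} {ζ : K} (h : ζ ^ n = 1) (k : ℕ) :
    ζ ^ (k : ZMod n).val = ζ ^ k := by
  rw [ZMod.val_natCast]
  conv_rhs => rw [← Nat.mod_add_div k n, pow_add, pow_mul, h, one_pow, mul_one]

/-- The character `i ↦ ζ ^ (e * i)` of `ℤ / n`. -/
def expChar {n : ℕ} [NeZero n] {ζ : K} (h : ζ ^ n = 1) (e : ZMod n) : AddChar (ZMod n) K :=
  AddChar.zmodChar n (ζ := ζ ^ e.val) (by rw [← pow_mul, mul_comm, pow_mul, h, one_pow])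

lemma expChar_apply {n : ℕ} [NeZero n] {ζ : K} (h : ζ ^ n = 1) (e i : ZMod n) :
    expChar h e i = (ζ ^ e.val) ^ i.val := AddChar.zmodChar_apply _ _

lemma expChar_apply_one {n : ℕ} [NeZero n] {ζ : K} (h : ζ ^ n = 1) (e : ZMod n) :
    expChar h e 1 = ζ ^ e.val := by
  rw [expChar_apply]
  rw [← Nat.cast_one, pow_val_natCast, pow_one]
  rw [← pow_mul, mul_comm, pow_mul, h, one_pow]

lemma expChar_injective {n : ℕ} [NeZero n] {ζ : K} (h : IsPrimitiveRoot ζ n) :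
    Function.Injective (expChar h.pow_eq_one) := by
  intro e e' he
  have := DFunLike.congr_fun he 1
  rw [expChar_apply_one, expChar_apply_one] at this
  exact ZMod.val_injective n (h.pow_inj e.val_lt e'.val_lt this)

lemma expChar_two_mul {n : ℕ} [NeZero n] {ζ : K} (h : ζ ^ n = 1) (e : ZMod n) :
    expChar h (2 * e) = expChar h e ^ 2 := by
  ext i
  rw [AddChar.pow_apply, expChar_apply, expChar_apply]
  have : (2 * e).val = ((2 * e.val : ℕ) : ZMod n).val := by simp
  rw [this, pow_val_natCast h, pow_mul, ← pow_mul, ← pow_mul, ← pow_mul, ← pow_mul]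
  congr 1; ring

/-- The character `(j₁, j₂) ↦ ζ₁ ^ (e₁ * j₁) * ζ₂ ^ (e₂ * j₂)` of `ℤ / r₁ × ℤ / r₂`. -/
def expChar₂ {r₁ r₂ : ℕ} [NeZero r₁] [NeZero r₂] {ζ₁ ζ₂ : K} (h₁ : ζ₁ ^ r₁ = 1)
    (h₂ : ζ₂ ^ r₂ = 1) (e : ZMod r₁ × ZMod r₂) : AddChar (ZMod r₁ × ZMod r₂) K :=
  (expChar h₁ e.1).compAddMonoidHom (AddMonoidHom.fst _ _) *
    (expChar h₂ e.2).compAddMonoidHom (AddMonoidHom.snd _ _)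

lemma expChar₂_apply {r₁ r₂ : ℕ} [NeZero r₁] [NeZero r₂] {ζ₁ ζ₂ : K} (h₁ : ζ₁ ^ r₁ = 1)
    (h₂ : ζ₂ ^ r₂ = 1) (e j : ZMod r₁ × ZMod r₂) :
    expChar₂ h₁ h₂ e j = expChar h₁ e.1 j.1 * expChar h₂ e.2 j.2 := rfl

lemma expChar₂_injective {r₁ r₂ : ℕ} [NeZero r₁] [NeZero r₂] {ζ₁ ζ₂ : K}
    (h₁ : IsPrimitiveRoot ζ₁ r₁) (h₂ : IsPrimitiveRoot ζ₂ r₂) :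
    Function.Injective (expChar₂ h₁.pow_eq_one h₂.pow_eq_one) := by
  intro e e' he
  refine Prod.ext (expChar_injective h₁ ?_) (expChar_injective h₂ ?_)
  · ext i
    simpa [expChar₂_apply] using DFunLike.congr_fun he (i, 0)
  · ext i
    simpa [expChar₂_apply] using DFunLike.congr_fun he (0, i)

lemma expChar₂_two_mul {r₁ r₂ : ℕ} [NeZero r₁] [NeZero r₂] {ζ₁ ζ₂ : K} (h₁ : ζ₁ ^ r₁ = 1)
    (h₂ : ζ₂ ^ r₂ = 1) (e : ZMod r₁ × ZMod r₂) :
    expChar₂ h₁ h₂ (2 * e) = expChar₂ h₁ h₂ e ^ 2 := by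
  ext j
  rw [AddChar.pow_apply, expChar₂_apply, expChar₂_apply, Prod.fst_mul, Prod.snd_mul, mul_pow]
  rw [← AddChar.pow_apply, ← AddChar.pow_apply, ← expChar_two_mul, ← expChar_two_mul]
  rfl

lemma addChar_pow_two_pow_card [Fintype K] {G : Type*} [AddCommGroup G] {m : ℕ}
    (hK : Fintype.card K = 2 ^ m)
    (ψ : AddChar G K) : ψ ^ 2 ^ m = ψ := by
  ext x
  rw [AddChar.pow_apply, ← hK, FiniteField.pow_card]

variable [Algebra (ZMod 2) K]

lemma exists_algebraMap_eq_of_sq_eq {x : K} (h : x ^ 2 = x) :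
    ∃ c : ZMod 2, algebraMap (ZMod 2) K c = x := by
  rcases eq_or_ne x 0 with rfl | hx
  · exact ⟨0, map_zero _⟩
  · refine ⟨1, ?_⟩
    rw [map_one]
    rw [sq] at h
    exact (mul_eq_left₀ hx).1 h |>.symm

variable [Fintype K] {m : ℕ}

/-- If a set `S` of characters is closed under square roots, then every character outside `S` is
separated from `S` by a binary word. The word is the sum of the inverses of the characters in the
orbit of `ψ₀` under squaring: its values are fixed by the Frobenius map, and orthogonality of
characters gives its Fourier transform. -/
lemma exists_word_separating {G : Type*} [AddCommGroup G] [Fintype G]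
    (hK : Fintype.card K = 2 ^ m) (hm : 0 < m) (hG : (Fintype.card G : K) ≠ 0)
    {S : Set (AddChar G K)} (hS : ∀ ψ ∈ S, ∃ φ ∈ S, ψ = φ ^ 2) {ψ₀ : AddChar G K} (h₀ : ψ₀ ∉ S) :
    ∃ c : G → ZMod 2, (∀ ψ ∈ S, ∑ j, c j • ψ j = 0) ∧ ∑ j, c j • ψ₀ j ≠ 0 := by
  classical
  have := charP_two_of_algebra K
  have hinj : Function.Injective (fun ψ : AddChar G K => ψ ^ 2) := by
    intro ψ φ h
    rw [← addChar_pow_two_pow_card hK ψ, ← addChar_pow_two_pow_card hK φ,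
      ← Nat.sub_add_cancel hm, pow_succ', pow_mul, pow_mul]
    exact congrArg (· ^ 2 ^ (m - 1)) h
  set O : Finset (AddChar G K) := (range m).image fun i => ψ₀ ^ 2 ^ i with hO
  have hO₀ : ψ₀ ∈ O := mem_image.2 ⟨0, mem_range.2 hm, by simp⟩
  have hsq : O.image (fun ψ => ψ ^ 2) = O := by
    apply Finset.eq_of_subset_of_card_le
    · intro ψ hψ
      simp only [hO, mem_image, mem_range, exists_exists_and_eq_and] at hψ ⊢
      obtain ⟨i, hi, rfl⟩ := hψ
      rw [← pow_mul, ← pow_succ]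
      by_cases him : i + 1 = m
      · exact ⟨0, hm, by rw [him, addChar_pow_two_pow_card hK]; simp⟩
      · exact ⟨i + 1, by omega, rfl⟩
    · rw [Finset.card_image_of_injective _ hinj]
  have hOS : ∀ ψ ∈ O, ψ ∉ S := by
    have (i : ℕ) : ψ₀ ^ 2 ^ i ∉ S := by
      induction i with
      | zero => simpa using h₀
      | succ i ih =>
        intro h
        obtain ⟨φ, hφ, h2⟩ := hS _ h
        rw [pow_succ, pow_mul] at h2
        exact ih (hinj h2 ▸ hφ)
    intro ψ hψ
    obtain ⟨i, -, rfl⟩ := mem_image.1 hψ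
    exact this i
  have hfix (j : G) : (∑ ψ ∈ O, ψ⁻¹ j) ^ 2 = ∑ ψ ∈ O, ψ⁻¹ j := by
    rw [sum_pow_char]
    conv_rhs => rw [← hsq, Finset.sum_image hinj.injOn]
    refine Finset.sum_congr rfl fun ψ _ => ?_
    rw [AddChar.inv_apply, AddChar.inv_apply, AddChar.pow_apply]
  choose c hc using fun j => exists_algebraMap_eq_of_sq_eq (hfix j)
  have hsum (φ : AddChar G K) :
      ∑ j, c j • φ j = if φ ∈ O then (Fintype.card G : K) else 0 := by
    simp_rw [Algebra.smul_def, hc, Finset.sum_mul]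
    rw [Finset.sum_comm]
    have (ψ : AddChar G K) : ∑ j, ψ⁻¹ j * φ j = if φ = ψ then (Fintype.card G : K) else 0 := by
      simp_rw [← AddChar.mul_apply]
      rw [AddChar.sum_eq_ite]
      congr 1
      rw [← AddChar.one_eq_zero, inv_mul_eq_one, eq_comm (a := φ)]
    simp_rw [this]
    rw [Finset.sum_ite_eq]
  refine ⟨c, fun ψ hψ => ?_, ?_⟩
  · rw [hsum, if_neg fun h => hOS ψ h hψ]
  · rwa [hsum, if_pos hO₀]

/-- Every set of exponents that is closed under halving is the defining set of an abelian code. -/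
lemma exists_abelianDefiningSet_eq {r₁ r₂ : ℕ} [NeZero r₁] [NeZero r₂] {β₁ β₂ : K}
    (hK : Fintype.card K = 2 ^ m) (hm : 0 < m) (h₁ : IsPrimitiveRoot β₁ r₁)
    (h₂ : IsPrimitiveRoot β₂ r₂) {D : Set (ZMod r₁ × ZMod r₂)}
    (hD : ∀ e ∈ D, ∃ d ∈ D, e = 2 * d) :
    ∃ C : Ideal (AbelianAlgebra r₁ r₂), abelianDefiningSet β₁ β₂ C = D := by
  classical
  let χ := expChar₂ h₁.pow_eq_one h₂.pow_eq_one
  let ev (e : ZMod r₁ × ZMod r₂) : AbelianAlgebra r₁ r₂ →ₐ[ZMod 2] K :=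
    AddMonoidAlgebra.lift (ZMod 2) K (ZMod r₁ × ZMod r₂) (χ e).toMonoidHom
  have hev (e : ZMod r₁ × ZMod r₂) (P : AbelianAlgebra r₁ r₂) :
      evalAt P (β₁ ^ e.1.val) (β₂ ^ e.2.val) = ev e P := by
    rw [AddMonoidAlgebra.lift_apply]
    refine Finsupp.sum_congr fun j _ => ?_
    congr 1
  refine ⟨⨅ e ∈ D, RingHom.ker (ev e), ?_⟩
  ext e
  simp only [abelianDefiningSet, hev, Set.mem_ofPred_eq, Submodule.mem_iInf, RingHom.mem_ker]
  refine ⟨fun h => ?_, fun he P hP => hP e he⟩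
  by_contra he
  have hcard : (Fintype.card (ZMod r₁ × ZMod r₂) : K) ≠ 0 := by
    rw [Fintype.card_prod, ZMod.card, ZMod.card, Nat.cast_mul]
    exact mul_ne_zero (h₁.neZero').out (h₂.neZero').out
  obtain ⟨c, hc, hc0⟩ := exists_word_separating hK hm hcard (S := χ '' D) (ψ₀ := χ e)
    (by
      rintro _ ⟨d, hd, rfl⟩
      obtain ⟨d', hd', rfl⟩ := hD d hd
      exact ⟨χ d', ⟨d', hd', rfl⟩, expChar₂_two_mul _ _ _⟩)
    (by
      rintro ⟨d, hd, hde⟩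
      exact he (expChar₂_injective h₁ h₂ hde ▸ hd))
  have hP (d : ZMod r₁ × ZMod r₂) :
      ev d (AddMonoidAlgebra.ofCoeff (Finsupp.equivFunOnFinite.symm c)) = ∑ j, c j • χ d j := by
    rw [AddMonoidAlgebra.lift_apply, AddMonoidAlgebra.coeff_ofCoeff, Finsupp.sum_fintype]
    · rfl
    · simp
  apply hc0
  rw [← hP]
  apply h
  intro d hd
  rw [hP]
  exact hc _ ⟨d, hd, rfl⟩

end Characters

/-! ### The punctured code and its defining set -/

/-- The residues modulo `n` of the numbers `2 ^ i + 2 ^ j` with `i, j < m`. For `n = 2 ^ m - 1`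
these are the exponents of `2`-weight `1` or `2`. -/
def pairExponents (m n : ℕ) : Finset (ZMod n) :=
  (range m).sym2.image fun z => (pairPow z : ZMod n)

lemma two_pow_eq_one_zmod {m r : ℕ} (h : r ∣ 2 ^ m - 1) : (2 : ZMod r) ^ m = 1 := by
  have h1 : ((2 ^ m - 1 : ℕ) : ZMod r) = 0 := (ZMod.natCast_eq_zero_iff _ _).2 h
  rw [Nat.cast_sub Nat.one_le_two_pow] at h1
  simpa [sub_eq_zero] using h1

lemma exists_half_mem_pairExponents {m n : ℕ} (hn : n ∣ 2 ^ m - 1) {e : ZMod n}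
    (he : e ∈ pairExponents m n) : ∃ d ∈ pairExponents m n, e = 2 * d := by
  obtain ⟨z, hz, rfl⟩ := mem_image.1 he
  obtain ⟨w, hw, h⟩ := exists_sq_pairPow hz
  refine ⟨pairPow w, mem_image_of_mem _ hw, ?_⟩
  have h1 := h (Multiplicative.ofAdd (1 : ZMod n)) (by
    rw [← ofAdd_nsmul, nsmul_one, Nat.cast_pow, Nat.cast_ofNat, two_pow_eq_one_zmod hn])
  rw [← ofAdd_nsmul, ← ofAdd_nsmul, ← ofAdd_nsmul] at h1
  simpa using Multiplicative.ofAdd.injective h1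

lemma two_mul_mem_pairExponents {m n : ℕ} (hn : n ∣ 2 ^ m - 1) {e : ZMod n}
    (he : e ∈ pairExponents m n) : 2 * e ∈ pairExponents m n := by
  have h2 := two_pow_eq_one_zmod hn
  have h (k : ℕ) : ∃ d ∈ pairExponents m n, e = 2 ^ k * d := by
    induction k with
    | zero => exact ⟨e, he, by simp⟩
    | succ k ih =>
      obtain ⟨d, hd, h⟩ := ih
      obtain ⟨d', hd', h'⟩ := exists_half_mem_pairExponents hn hd
      exact ⟨d', hd', by rw [h, h', pow_succ, mul_assoc]⟩
  rcases Nat.eq_zero_or_pos m with rfl | hm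
  · simp [pairExponents] at he
  · obtain ⟨d, hd, rfl⟩ := h (m - 1)
    rwa [← mul_assoc, ← pow_succ', Nat.sub_add_cancel hm, h2, one_mul]

section Puncture

variable {K : Type*} [Field K] {m n : ℕ} [NeZero n] {α : K}

lemma pow_val_injective (hα : IsPrimitiveRoot α n) :
    Function.Injective (fun i : ZMod n => α ^ i.val) :=
  fun i j h => ZMod.val_injective n (hα.pow_inj i.val_lt j.val_lt h)

variable [Fintype K]

lemma exists_pow_val_eq (hα : IsPrimitiveRoot α n) (hn : n = Fintype.card K - 1) {g : K}
    (hg : g ≠ 0) : ∃ i : ZMod n, α ^ i.val = g := by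
  classical
  have h : univ.image (fun i : ZMod n => α ^ i.val) = univ.erase 0 := by
    apply Finset.eq_of_subset_of_card_le
    · intro x hx
      obtain ⟨i, -, rfl⟩ := mem_image.1 hx
      simp [hα.ne_zero (NeZero.ne n)]
    · rw [Finset.card_image_of_injective _ (pow_val_injective hα), Finset.card_univ, ZMod.card,
        Finset.card_erase_of_mem (mem_univ _), Finset.card_univ, hn]
  have : g ∈ univ.image (fun i : ZMod n => α ^ i.val) := by rw [h]; simpa using hg
  simpa using this

/-- The nonzero elements of the field are the powers of the primitive root `α`. -/
lemma sum_eq_add_sum_pow {M : Type*} [AddCommMonoid M] (hα : IsPrimitiveRoot α n)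
    (hn : n = Fintype.card K - 1) (F : K → M) :
    ∑ g, F g = F 0 + ∑ i : ZMod n, F (α ^ i.val) := by
  classical
  rw [← Finset.add_sum_erase _ _ (mem_univ (0 : K))]
  congr 1
  symm
  refine Finset.sum_bij (fun i _ => α ^ i.val) ?_ (fun i _ j _ h => pow_val_injective hα h) ?_
    (fun _ _ => rfl)
  · intro i _
    simp [hα.ne_zero (NeZero.ne n)]
  · intro g hg
    obtain ⟨i, hi⟩ := exists_pow_val_eq hα hn (g := g) (by simpa using hg)
    exact ⟨i, mem_univ _, hi⟩

variable [Algebra (ZMod 2) K]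

/-- The value at `0` of a word of the Reed-Muller code is a parity check of the other values. -/
lemma mem_puncture_iff (hα : IsPrimitiveRoot α n) (hn : n = 2 ^ m - 1)
    (hK : Fintype.card K = 2 ^ m) (hm : 3 ≤ m) {c : ZMod n → ZMod 2} :
    c ∈ puncture α (reedMuller K (m - 3) m) ↔
      ∀ e ∈ pairExponents m n, ∑ i, c i • expChar hα.pow_eq_one e i = 0 := by
  classical
  have hn' : n = Fintype.card K - 1 := by rw [hn, hK]
  have hχ (z : Sym2 ℕ) (i : ZMod n) :
      expChar hα.pow_eq_one (pairPow z : ZMod n) i = (α ^ i.val) ^ pairPow z := by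
    rw [expChar_apply, pow_val_natCast hα.pow_eq_one, pow_right_comm]
  have h0 (z : Sym2 ℕ) : (0 : K) ^ pairPow z = 0 :=
    zero_pow (by have := two_le_pairPow z; omega)
  constructor
  · rintro ⟨x, hx, rfl⟩ e he
    obtain ⟨z, hz, rfl⟩ := mem_image.1 he
    have := ((mem_reedMuller_sub_three hK hm).1 hx).2 z hz
    rw [sum_eq_add_sum_pow hα hn', h0, smul_zero, zero_add] at this
    simpa [hχ, LinearMap.funLeft] using this
  · intro h
    have hex : ∃ x : K → ZMod 2, x 0 = ∑ i, c i ∧ ∀ i : ZMod n, x (α ^ i.val) = c i := by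
      refine ⟨fun g => if h : ∃ i : ZMod n, α ^ i.val = g then c h.choose else ∑ i, c i, ?_, ?_⟩
      · beta_reduce
        rw [dif_neg]
        rintro ⟨i, hi⟩
        exact hα.ne_zero (NeZero.ne n) (eq_zero_of_pow_eq_zero hi)
      · intro i
        beta_reduce
        have hi : ∃ j : ZMod n, α ^ j.val = α ^ i.val := ⟨i, rfl⟩
        rw [dif_pos hi, pow_val_injective hα hi.choose_spec]
    obtain ⟨x, hx0, hx⟩ := hex
    refine ⟨x, (mem_reedMuller_sub_three hK hm).2 ⟨?_, fun z hz => ?_⟩, funext hx⟩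
    · rw [sum_eq_add_sum_pow hα hn', hx0]
      simp_rw [hx]
      exact CharTwo.add_self_eq_zero _
    · rw [sum_eq_add_sum_pow hα hn', h0, smul_zero, zero_add]
      simp_rw [hx, ← hχ]
      exact h _ (mem_image_of_mem _ hz)

lemma cyclicDefiningSet_puncture (hα : IsPrimitiveRoot α n) (hn : n = 2 ^ m - 1)
    (hK : Fintype.card K = 2 ^ m) (hm : 3 ≤ m) :
    cyclicDefiningSet α (puncture α (reedMuller K (m - 3) m)) =
      (pairExponents m n : Set (ZMod n)) := by
  ext e
  simp only [cyclicDefiningSet, Set.mem_ofPred_eq, mem_puncture_iff hα hn hK hm,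
    ← expChar_apply hα.pow_eq_one]
  refine ⟨fun h => ?_, fun he c hc => hc e he⟩
  by_contra he
  have hcard : (Fintype.card (ZMod n) : K) ≠ 0 := by
    rw [ZMod.card]
    exact hα.neZero'.out
  obtain ⟨c, hc, hc0⟩ := exists_word_separating hK (by omega) hcard
    (S := expChar hα.pow_eq_one '' pairExponents m n) (ψ₀ := expChar hα.pow_eq_one e)
    (by
      rintro _ ⟨d, hd, rfl⟩
      obtain ⟨d', hd', rfl⟩ := exists_half_mem_pairExponents hn.dvd hd
      exact ⟨_, ⟨d', hd', rfl⟩, expChar_two_mul _ _⟩)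
    (by
      rintro ⟨d, hd, hde⟩
      exact he (expChar_injective hα hde ▸ hd))
  exact hc0 (h c fun d hd => hc _ ⟨d, hd, rfl⟩)

/-- A set of check positions of the punctured code, together with the position `0`, is a set of
check positions of the Reed-Muller code. -/
lemma IsInformationSet.of_puncture (hα : IsPrimitiveRoot α n) (hn : n = 2 ^ m - 1)
    (hK : Fintype.card K = 2 ^ m) (hm : 3 ≤ m) {I : Set (ZMod n)}
    (h : IsInformationSet (puncture α (reedMuller K (m - 3) m)) I) :
    IsInformationSet (reedMuller K (m - 3) m) ((fun i : ZMod n => α ^ i.val) '' I) := by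
  have hn' : n = Fintype.card K - 1 := by rw [hn, hK]
  rw [isInformationSet_iff] at h ⊢
  refine ⟨fun x hx h0 => ?_, fun v => ?_⟩
  · have h1 := h.1 _ (Submodule.mem_map_of_mem hx) fun i hi => h0 _ ⟨i, hi, rfl⟩
    have h2 (i : ZMod n) : x (α ^ i.val) = 0 := congrFun h1 i
    have h3 := ((mem_reedMuller_sub_three hK hm).1 hx).1
    rw [sum_eq_add_sum_pow hα hn'] at h3
    simp_rw [h2] at h3
    funext g
    by_cases hg : g = 0
    · simpa [hg] using h3
    · obtain ⟨i, rfl⟩ := exists_pow_val_eq hα hn' hg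
      exact h2 i
  · obtain ⟨c, ⟨x, hx, rfl⟩, hc⟩ := h.2 (fun i => v (α ^ i.val))
    refine ⟨x, hx, ?_⟩
    rintro _ ⟨i, hi, rfl⟩
    exact hc i hi

end Puncture

/-! ### Restricted representatives -/

section Orbits

/-- If `f` fixes `x` after some positive number of steps, its orbit through `x` has as many
elements as the minimal period. -/
lemma ncard_orbit_eq_minimalPeriod {X : Type*} (f : X → X) (x : X)
    (h : x ∈ Function.periodicPts f) :
    {y | ∃ i, y = f^[i] x}.ncard = Function.minimalPeriod f x := by
  have h1 : {y | ∃ i, y = f^[i] x} =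
      (fun i => f^[i] x) '' Set.Iio (Function.minimalPeriod f x) := by
    ext y
    constructor
    · rintro ⟨i, rfl⟩
      exact ⟨i % Function.minimalPeriod f x,
        Nat.mod_lt _ (Function.minimalPeriod_pos_of_mem_periodicPts h),
        Function.iterate_mod_minimalPeriod_eq⟩
    · rintro ⟨i, -, rfl⟩
      exact ⟨i, rfl⟩
  rw [h1, Function.iterate_injOn_Iio_minimalPeriod.ncard_image, Set.ncard_eq_toFinset_card']
  simp

variable {r r₁ r₂ N : ℕ}

lemma mem_cyclotomicCoset_self (γ : ℕ) (x : ZMod r) : x ∈ cyclotomicCoset γ r x := ⟨0, by simp⟩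

/-- `2 ^ i` has the inverse `2 ^ (i * (N - 1))` modulo a divisor of `2 ^ N - 1`. -/
lemma two_pow_mul_two_pow_eq_one (hN : 0 < N) (h : (2 : ZMod r) ^ N = 1) (i : ℕ) :
    (2 : ZMod r) ^ i * 2 ^ (i * (N - 1)) = 1 := by
  obtain ⟨N, rfl⟩ := Nat.exists_eq_add_of_le' hN
  rw [← pow_add, Nat.add_sub_cancel, show i + i * N = (N + 1) * i by ring, pow_mul, h, one_pow]

lemma mem_cyclotomicCoset_comm (hN : 0 < N) (h : (2 : ZMod r) ^ N = 1) {γ : ℕ} {x y : ZMod r}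
    (hy : y ∈ cyclotomicCoset γ r x) : x ∈ cyclotomicCoset γ r y := by
  obtain ⟨i, rfl⟩ := hy
  refine ⟨i * (N - 1), ?_⟩
  rw [mul_assoc, ← mul_assoc γ, two_pow_mul_two_pow_eq_one hN h, mul_one]

lemma cyclotomicCoset_subset {γ : ℕ} {x y : ZMod r}
    (hy : y ∈ cyclotomicCoset γ r x) : cyclotomicCoset γ r y ⊆ cyclotomicCoset γ r x := by
  obtain ⟨i, rfl⟩ := hy
  rintro _ ⟨j, rfl⟩
  exact ⟨i + j, by rw [mul_assoc, ← pow_add, mul_add]⟩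

lemma cyclotomicCoset_eq_iff (hN : 0 < N) (h : (2 : ZMod r) ^ N = 1) {γ : ℕ} {x y : ZMod r} :
    cyclotomicCoset γ r y = cyclotomicCoset γ r x ↔ y ∈ cyclotomicCoset γ r x :=
  ⟨fun he => he ▸ mem_cyclotomicCoset_self γ y, fun hy => Set.Subset.antisymm
    (cyclotomicCoset_subset hy) (cyclotomicCoset_subset (mem_cyclotomicCoset_comm hN h hy))⟩

lemma mem_twoOrbit_self (e : ZMod r₁ × ZMod r₂) : e ∈ twoOrbit e := ⟨0, by simp⟩

lemma twoOrbit_subset {e d : ZMod r₁ × ZMod r₂} (h : d ∈ twoOrbit e) :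
    twoOrbit d ⊆ twoOrbit e := by
  obtain ⟨i, rfl⟩ := h
  rintro _ ⟨j, rfl⟩
  exact ⟨i + j, by simp [mul_assoc, pow_add]⟩

lemma mem_twoOrbit_comm (hN : 0 < N) (h₁ : (2 : ZMod r₁) ^ N = 1) (h₂ : (2 : ZMod r₂) ^ N = 1)
    {e d : ZMod r₁ × ZMod r₂} (h : d ∈ twoOrbit e) : e ∈ twoOrbit d := by
  obtain ⟨i, rfl⟩ := h
  refine ⟨i * (N - 1), ?_⟩
  rw [mul_assoc, mul_assoc, two_pow_mul_two_pow_eq_one hN h₁, two_pow_mul_two_pow_eq_one hN h₂,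
    mul_one, mul_one]

lemma twoOrbit_eq_iff (hN : 0 < N) (h₁ : (2 : ZMod r₁) ^ N = 1) (h₂ : (2 : ZMod r₂) ^ N = 1)
    {e d : ZMod r₁ × ZMod r₂} : twoOrbit d = twoOrbit e ↔ d ∈ twoOrbit e :=
  ⟨fun he => he ▸ mem_twoOrbit_self d, fun hd => Set.Subset.antisymm
    (twoOrbit_subset hd) (twoOrbit_subset (mem_twoOrbit_comm hN h₁ h₂ hd))⟩

/-- The length of the cyclotomic coset of `x` divides exactly the exponents of the powers of `2`
that fix `x`. -/
lemma mul_two_pow_eq_self_iff (hN : 0 < N) (h : (2 : ZMod r) ^ N = 1) (x : ZMod r) (k : ℕ) :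
    x * 2 ^ k = x ↔ mFst x ∣ k := by
  have hit (i : ℕ) : (fun y : ZMod r => y * 2)^[i] x = x * 2 ^ i := by
    rw [mul_right_iterate]
  have hm : mFst x = Function.minimalPeriod (fun y : ZMod r => y * 2) x := by
    rw [← ncard_orbit_eq_minimalPeriod]
    · simp [mFst, cyclotomicCoset, hit]
    · exact ⟨N, hN, by rw [Function.IsPeriodicPt, Function.IsFixedPt, hit, h, mul_one]⟩
  rw [hm, ← Function.isPeriodicPt_iff_minimalPeriod_dvd, Function.IsPeriodicPt,
    Function.IsFixedPt, hit]

end Orbits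

section RestrictedReps

variable {r₁ r₂ N : ℕ}

/-- The number of elements of `D` over `x`. -/
noncomputable def fibreCard (D : Set (ZMod r₁ × ZMod r₂)) (x : ZMod r₁) : ℕ :=
  {y | (x, y) ∈ D}.ncard

variable {D : Set (ZMod r₁ × ZMod r₂)} {R : Finset (ZMod r₁ × ZMod r₂)}

lemma mul_two_pow_mem (hD : ∀ e ∈ D, 2 * e ∈ D) {e : ZMod r₁ × ZMod r₂} (he : e ∈ D) (i : ℕ) :
    (e.1 * 2 ^ i, e.2 * 2 ^ i) ∈ D := by
  induction i with
  | zero => simpa using he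
  | succ i ih =>
    convert hD _ ih using 1
    ext <;> simp [pow_succ] <;> ring

lemma IsRestrictedReps.eq_of_fst_mem_coset (hR : IsRestrictedReps R D) (hN : 0 < N)
    (h₁ : (2 : ZMod r₁) ^ N = 1) {x y : ZMod r₁} (hx : x ∈ R.image Prod.fst)
    (hy : y ∈ R.image Prod.fst) (hxy : y ∈ cyclotomicCoset 1 r₁ x) : y = x := by
  obtain ⟨e, he, rfl⟩ := mem_image.1 hx
  obtain ⟨z, -, hz⟩ := hR.2.2 e.1 ⟨e, hR.1 he, rfl⟩
  rw [hz y ⟨hy, (cyclotomicCoset_eq_iff hN h₁).2 hxy⟩, hz e.1 ⟨hx, rfl⟩]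

variable [NeZero r₂]

/-- The number of elements over `x` is constant on cyclotomic cosets. -/
lemma fibreCard_mul_two_pow (hN : 0 < N) (h₁ : (2 : ZMod r₁) ^ N = 1)
    (h₂ : (2 : ZMod r₂) ^ N = 1) (hD : ∀ e ∈ D, 2 * e ∈ D) (x : ZMod r₁) (i : ℕ) :
    fibreCard D (x * 2 ^ i) = fibreCard D x := by
  have key (x : ZMod r₁) (i : ℕ) : fibreCard D x ≤ fibreCard D (x * 2 ^ i) := by
    apply Set.ncard_le_ncard_of_injOn (fun y => y * 2 ^ i)
    · intro y hy
      exact mul_two_pow_mem hD hy i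
    · intro y _ y' _ h
      have := congrArg (· * (2 : ZMod r₂) ^ (i * (N - 1))) h
      simpa [mul_assoc, two_pow_mul_two_pow_eq_one hN h₂] using this
  refine le_antisymm ?_ (key x i)
  have := key (x * 2 ^ i) (i * (N - 1))
  rwa [mul_assoc, two_pow_mul_two_pow_eq_one hN h₁, mul_one] at this

/-- The `2 ^ m(x)`-cyclotomic cosets of the representatives over `x` partition the elements of `D`
over `x`. -/
lemma IsRestrictedReps.bigM_eq_fibreCard (hR : IsRestrictedReps R D) (hN : 0 < N)
    (h₁ : (2 : ZMod r₁) ^ N = 1) (h₂ : (2 : ZMod r₂) ^ N = 1) (hD : ∀ e ∈ D, 2 * e ∈ D)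
    {x : ZMod r₁} (hx : x ∈ R.image Prod.fst) : bigM R x = fibreCard D x := by
  classical
  have hcov : {y | (x, y) ∈ D} =
      ((R.filter (·.1 = x)).biUnion fun d => (cyclotomicCoset (mFst d.1) r₂ d.2).toFinset :
        Finset (ZMod r₂)) := by
    ext y
    simp only [Set.mem_ofPred_eq, Finset.coe_biUnion, Finset.coe_filter, Set.mem_iUnion,
      Set.coe_toFinset, exists_prop]
    constructor
    · intro hy
      obtain ⟨d, ⟨hd, hdo⟩, -⟩ := hR.2.1 _ hy
      obtain ⟨k, hk⟩ := mem_twoOrbit_comm hN h₁ h₂ ((twoOrbit_eq_iff hN h₁ h₂).1 hdo)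
      obtain ⟨hk1, hk2⟩ := Prod.ext_iff.1 hk
      simp only at hk1 hk2
      have hdx : d.1 = x := by
        refine hR.eq_of_fst_mem_coset hN h₁ hx (mem_image_of_mem _ hd)
          (mem_cyclotomicCoset_comm hN h₁ ⟨k, by rw [one_mul, hk1]⟩)
      rw [← hdx] at hk1
      obtain ⟨i, rfl⟩ := (mul_two_pow_eq_self_iff hN h₁ d.1 k).1 hk1.symm
      exact ⟨d, ⟨hd, hdx⟩, i, hk2⟩
    · rintro ⟨d, ⟨hd, rfl⟩, i, rfl⟩
      have := mul_two_pow_mem hD (hR.1 hd) (mFst d.1 * i)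
      rwa [(mul_two_pow_eq_self_iff hN h₁ d.1 _).2 (dvd_mul_right _ _)] at this
  rw [fibreCard, hcov, Set.ncard_coe_finset, Finset.card_biUnion]
  · refine Finset.sum_congr rfl fun d _ => ?_
    rw [mPair, Set.ncard_eq_toFinset_card']
  · intro d hd d' hd' hne
    rw [Finset.coe_filter] at hd hd'
    rw [Function.onFun, Set.disjoint_toFinset, Set.disjoint_left]
    rintro y hy hy'
    apply hne
    obtain ⟨hd, rfl⟩ := hd
    obtain ⟨hd', hdd⟩ := hd'
    rw [hdd] at hy'
    have hmem : d.2 ∈ cyclotomicCoset (mFst d.1) r₂ d'.2 :=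
      cyclotomicCoset_subset hy' (mem_cyclotomicCoset_comm hN h₂ hy)
    obtain ⟨i, hi⟩ := hmem
    have ho : twoOrbit d = twoOrbit d' := by
      rw [twoOrbit_eq_iff hN h₁ h₂]
      refine ⟨mFst d.1 * i, Prod.ext ?_ hi⟩
      rw [hdd, (mul_two_pow_eq_self_iff hN h₁ d.1 _).2 (dvd_mul_right _ _)]
    obtain ⟨_, -, hu⟩ := hR.2.1 d (hR.1 hd)
    rw [hu d ⟨hd, rfl⟩, hu d' ⟨hd', ho.symm⟩]

lemma IsRestrictedReps.mem_bigMValues_iff (hR : IsRestrictedReps R D) (hN : 0 < N)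
    (h₁ : (2 : ZMod r₁) ^ N = 1) (h₂ : (2 : ZMod r₂) ^ N = 1) (hD : ∀ e ∈ D, 2 * e ∈ D) (f : ℕ) :
    f ∈ bigMValues R ↔ ∃ x ∈ Prod.fst '' D, fibreCard D x = f := by
  rw [bigMValues, mem_image]
  constructor
  · rintro ⟨x, hx, rfl⟩
    rw [hR.bigM_eq_fibreCard hN h₁ h₂ hD hx]
    obtain ⟨d, hd, rfl⟩ := mem_image.1 hx
    exact ⟨d.1, ⟨d, hR.1 hd, rfl⟩, rfl⟩
  · rintro ⟨x, hx, rfl⟩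
    obtain ⟨y, ⟨hy, hyx⟩, -⟩ := hR.2.2 x hx
    obtain ⟨i, rfl⟩ := (cyclotomicCoset_eq_iff hN h₁).1 hyx
    refine ⟨_, hy, ?_⟩
    rw [hR.bigM_eq_fibreCard hN h₁ h₂ hD hy, fibreCard_mul_two_pow hN h₁ h₂ hD]

variable [NeZero r₁]

/-- The cyclotomic cosets of the representatives partition the first projection of `D`. -/
lemma IsRestrictedReps.sum_mFst_eq (hR : IsRestrictedReps R D) (hN : 0 < N)
    (h₁ : (2 : ZMod r₁) ^ N = 1) (h₂ : (2 : ZMod r₂) ^ N = 1) (hD : ∀ e ∈ D, 2 * e ∈ D) (f : ℕ) :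
    ∑ x ∈ R.image Prod.fst with f ≤ fibreCard D x, mFst x =
      {x ∈ Prod.fst '' D | f ≤ fibreCard D x}.ncard := by
  classical
  have hcov : {x ∈ Prod.fst '' D | f ≤ fibreCard D x} =
      (((R.image Prod.fst).filter (f ≤ fibreCard D ·)).biUnion fun x =>
        (cyclotomicCoset 1 r₁ x).toFinset : Finset (ZMod r₁)) := by
    ext x
    simp only [Set.mem_ofPred_eq, Finset.coe_biUnion, Finset.coe_filter, Set.mem_iUnion,
      Set.coe_toFinset, exists_prop]
    constructor
    · rintro ⟨hx, hf⟩
      obtain ⟨y, ⟨hy, hyx⟩, -⟩ := hR.2.2 x hx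
      rw [cyclotomicCoset_eq_iff hN h₁] at hyx
      refine ⟨y, ⟨hy, ?_⟩, mem_cyclotomicCoset_comm hN h₁ hyx⟩
      obtain ⟨i, rfl⟩ := hyx
      rwa [fibreCard_mul_two_pow hN h₁ h₂ hD]
    · rintro ⟨y, ⟨hy, hf⟩, i, rfl⟩
      rw [fibreCard_mul_two_pow hN h₁ h₂ hD]
      obtain ⟨d, hd, rfl⟩ := mem_image.1 hy
      exact ⟨⟨_, mul_two_pow_mem hD (hR.1 hd) (1 * i), rfl⟩, hf⟩
  rw [hcov, Set.ncard_coe_finset, Finset.card_biUnion]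
  · refine Finset.sum_congr rfl fun x _ => ?_
    rw [mFst, Set.ncard_eq_toFinset_card']
  · intro x hx x' hx' hne
    rw [Finset.coe_filter] at hx hx'
    rw [Function.onFun, Set.disjoint_toFinset, Set.disjoint_left]
    rintro y hy hy'
    exact hne (hR.eq_of_fst_mem_coset hN h₁ hx'.1 hx.1
      (cyclotomicCoset_subset hy' (mem_cyclotomicCoset_comm hN h₁ hy)))

/-- Restricted representatives exist: first choose a representative `s x` in every coset of the
first projection, and then in every orbit an element over the chosen representative. -/
lemma exists_isRestrictedReps (hN : 0 < N) (h₁ : (2 : ZMod r₁) ^ N = 1)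
    (h₂ : (2 : ZMod r₂) ^ N = 1) (hD : ∀ e ∈ D, 2 * e ∈ D) : ∃ R, IsRestrictedReps R D := by
  classical
  -- `s` depends on the coset only
  have hs : ∃ s : ZMod r₁ → ZMod r₁, (∀ x, s x ∈ cyclotomicCoset 1 r₁ x) ∧
      ∀ x y, cyclotomicCoset 1 r₁ x = cyclotomicCoset 1 r₁ y → s x = s y := by
    let t : Set (ZMod r₁) → ZMod r₁ := fun A => if h : A.Nonempty then h.some else 0
    refine ⟨fun x => t (cyclotomicCoset 1 r₁ x), fun x => ?_, fun x y h => by simp only [h]⟩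
    have : (cyclotomicCoset 1 r₁ x).Nonempty := ⟨x, mem_cyclotomicCoset_self 1 x⟩
    simp only [t, dif_pos this]
    exact this.some_mem
  obtain ⟨s, hs, hs'⟩ := hs
  -- `c` depends on the orbit only
  have hc : ∃ c : ZMod r₁ × ZMod r₂ → ZMod r₁ × ZMod r₂,
      (∀ e, c e ∈ twoOrbit e ∧ (c e).1 = s e.1) ∧ ∀ e d, twoOrbit e = twoOrbit d → c e = c d := by
    let A : Set (ZMod r₁ × ZMod r₂) → Set (ZMod r₁ × ZMod r₂) := fun O => {d ∈ O | d.1 = s d.1}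
    let t : Set (ZMod r₁ × ZMod r₂) → ZMod r₁ × ZMod r₂ :=
      fun O => if h : (A O).Nonempty then h.some else 0
    refine ⟨fun e => t (twoOrbit e), fun e => ?_, fun e d h => by simp only [h]⟩
    have hsame {d : ZMod r₁ × ZMod r₂} (hd : d ∈ twoOrbit e) : s d.1 = s e.1 := by
      obtain ⟨i, rfl⟩ := hd
      exact hs' _ _ ((cyclotomicCoset_eq_iff hN h₁).2 ⟨i, by rw [one_mul]⟩)
    have hne : (A (twoOrbit e)).Nonempty := by
      obtain ⟨i, hi⟩ := hs e.1
      rw [one_mul] at hi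
      have hmem : (e.1 * 2 ^ i, e.2 * 2 ^ i) ∈ twoOrbit e := ⟨i, rfl⟩
      exact ⟨_, hmem, by rw [hsame hmem, hi]⟩
    have hmem := hne.some_mem
    simp only [t, dif_pos hne]
    exact ⟨hmem.1, hmem.2.trans (hsame hmem.1)⟩
  obtain ⟨c, hc, hc'⟩ := hc
  have hcD {e : ZMod r₁ × ZMod r₂} (he : e ∈ D) : c e ∈ D := by
    obtain ⟨i, hi⟩ := (hc e).1
    rw [hi]
    exact mul_two_pow_mem hD he i
  have hfin : D.Finite := Set.toFinite D
  have hmemR {d : ZMod r₁ × ZMod r₂} : d ∈ hfin.toFinset.image c ↔ ∃ e ∈ D, c e = d := by simp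
  have horb (e) : twoOrbit (c e) = twoOrbit e := (twoOrbit_eq_iff hN h₁ h₂).2 (hc e).1
  refine ⟨hfin.toFinset.image c, ?_, ?_, ?_⟩
  · intro d hd
    obtain ⟨e, he, rfl⟩ := hmemR.1 hd
    exact hcD he
  · intro e he
    refine ⟨c e, ⟨hmemR.2 ⟨e, he, rfl⟩, horb e⟩, ?_⟩
    rintro d ⟨hd, hde⟩
    obtain ⟨e', he', rfl⟩ := hmemR.1 hd
    rw [horb] at hde
    exact hc' _ _ hde
  · rintro _ ⟨e, he, rfl⟩
    refine ⟨s e.1, ⟨mem_image.2 ⟨c e, hmemR.2 ⟨e, he, rfl⟩, (hc e).2⟩,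
      (cyclotomicCoset_eq_iff hN h₁).2 (hs e.1)⟩, ?_⟩
    rintro y ⟨hy, hye⟩
    obtain ⟨d, hd, rfl⟩ := mem_image.1 hy
    obtain ⟨e', he', rfl⟩ := hmemR.1 hd
    rw [(hc e').2] at hye ⊢
    rw [← hs' _ _ hye]
    apply hs'
    exact ((cyclotomicCoset_eq_iff hN h₁).2 (hs e'.1)).symm

/-- The shape of `Γ` when the elements over the points of the first projection of `D` are `f` or
`f'` in number, with `f' < f`. -/
lemma IsRestrictedReps.parameters (hR : IsRestrictedReps R D) (hN : 0 < N)
    (h₁ : (2 : ZMod r₁) ^ N = 1) (h₂ : (2 : ZMod r₂) ^ N = 1) (hD : ∀ e ∈ D, 2 * e ∈ D)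
    {f f' g g' : ℕ} (hf : f' < f)
    (hval : ∀ k, (∃ x ∈ Prod.fst '' D, fibreCard D x = k) ↔ k = f ∨ k = f')
    (hg : {x ∈ Prod.fst '' D | f ≤ fibreCard D x}.ncard = g)
    (hg' : {x ∈ Prod.fst '' D | f' ≤ fibreCard D x}.ncard = g') :
    sLen R = 2 ∧ fSeq R 1 = f ∧ fSeq R 2 = f' ∧ gSeq R 1 = g ∧ gSeq R 2 = g' ∧
      gammaSet R = {i | (i.1.val < g ∧ i.2.val < f) ∨
        (g ≤ i.1.val ∧ i.1.val < g' ∧ i.2.val < f')} := by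
  have hV : bigMValues R = {f, f'} := by
    ext k
    rw [hR.mem_bigMValues_iff hN h₁ h₂ hD, hval, mem_insert, mem_singleton]
  have hs : sLen R = 2 := by rw [sLen, hV, Finset.card_pair hf.ne']
  have hf1 : fSeq R 1 = f := by
    rw [fSeq, hV]
    simp [hf.le]
  have hf2 : fSeq R 2 = f' := by
    rw [fSeq, hf1, hV, Finset.filter_insert, if_neg (lt_irrefl f), Finset.filter_singleton,
      if_pos hf]
    simp
  have hf3 : fSeq R 3 = 0 := by
    rw [fSeq, hf2, hV, Finset.filter_insert, if_neg hf.not_gt, Finset.filter_singleton,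
      if_neg (lt_irrefl f')]
    simp
  have hgS (i : ℕ) : gSeq R i = {x ∈ Prod.fst '' D | fSeq R i ≤ fibreCard D x}.ncard := by
    rw [← hR.sum_mFst_eq hN h₁ h₂ hD, gSeq]
    refine Finset.sum_congr (Finset.filter_congr fun x hx => ?_) fun _ _ => rfl
    rw [hR.bigM_eq_fibreCard hN h₁ h₂ hD hx]
  have hg1 : gSeq R 1 = g := by rw [hgS, hf1, hg]
  have hg2 : gSeq R 2 = g' := by rw [hgS, hf2, hg']
  have hgg : g ≤ g' := by
    rw [← hg, ← hg']
    exact Set.ncard_le_ncard (fun x hx => ⟨hx.1, hf.le.trans hx.2⟩) (Set.toFinite _)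
  refine ⟨hs, hf1, hf2, hg1, hg2, ?_⟩
  ext i
  simp only [gammaSet, Set.mem_ofPred_eq]
  constructor
  · rintro ⟨j, hj1, hj2, hlo, hhi, hi⟩
    rw [hs] at hj2
    obtain rfl | rfl : j = 1 ∨ j = 2 := by omega
    · rw [hf1] at hhi; rw [hg1] at hi
      exact Or.inl ⟨hi, hhi⟩
    · rw [hf2] at hhi; rw [hg2] at hi
      by_cases hig : i.1.val < g
      · exact Or.inl ⟨hig, hhi.trans hf⟩
      · exact Or.inr ⟨not_lt.1 hig, hi, hhi⟩
  · rintro (⟨h1, h2⟩ | ⟨-, h1, h2⟩)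
    · by_cases hlo : f' ≤ i.2.val
      · exact ⟨1, le_rfl, by omega, by rwa [hf2], by rwa [hf1], by rwa [hg1]⟩
      · exact ⟨2, by omega, by omega, by rw [hf3]; omega, by rw [hf2]; omega, by rw [hg2]; omega⟩
    · exact ⟨2, by omega, by omega, by rw [hf3]; omega, by rwa [hf2], by rwa [hg2]⟩

end RestrictedReps

/-! ### Counting exponents -/

section Counting

lemma filter_range_mod_eq {a b i : ℕ} (hi : i < a) :
    (range (a * b)).filter (· % a = i) = (range b).image (fun x => a * x + i) := by
  ext k
  simp only [mem_filter, mem_range, mem_image]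
  constructor
  · rintro ⟨hk, rfl⟩
    exact ⟨k / a, Nat.div_lt_of_lt_mul hk, Nat.div_add_mod k a⟩
  · rintro ⟨x, hx, rfl⟩
    refine ⟨?_, by rw [Nat.mul_add_mod, Nat.mod_eq_of_lt hi]⟩
    calc a * x + i < a * x + a := by omega
      _ = a * (x + 1) := by ring
      _ ≤ a * b := Nat.mul_le_mul_left _ hx

lemma card_filter_range_mod {a b i : ℕ} (hi : i < a) :
    #((range (a * b)).filter (· % a = i)) = b := by
  rw [filter_range_mod_eq hi, Finset.card_image_of_injective, card_range]
  intro x y h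
  have : a * x = a * y := by simpa using h
  exact Nat.eq_of_mul_eq_mul_left (by omega) this

/-- The number of unordered pairs of integers in `[0, ab)` that reduce modulo `a` to a given
unordered pair. -/
lemma card_filter_map_mod {a b : ℕ} {w : Sym2 ℕ} (hw : w ∈ (range a).sym2) :
    #((range (a * b)).sym2.filter fun z => z.map (· % a) = w) =
      if w.IsDiag then b * (b + 1) / 2 else b ^ 2 := by
  induction w with | _ i j
  rw [Finset.mk_mem_sym2_iff, mem_range, mem_range] at hw
  simp only [Sym2.mk_isDiag_iff]
  split_ifs with hij
  · subst hij
    have : (range (a * b)).sym2.filter (fun z => z.map (· % a) = s(i, i)) =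
        ((range (a * b)).filter (· % a = i)).sym2 := by
      ext z
      induction z with | _ k l
      simp only [mem_filter, Finset.mk_mem_sym2_iff, Sym2.map_mk, Sym2.eq_iff]
      tauto
    rw [this, Finset.card_sym2, card_filter_range_mod hw.1, Nat.choose_two_right,
      Nat.add_sub_cancel, mul_comm]
  · have : (range (a * b)).sym2.filter (fun z => z.map (· % a) = s(i, j)) =
        ((range (a * b)).filter (· % a = i) ×ˢ (range (a * b)).filter (· % a = j)).image
          (fun p => s(p.1, p.2)) := by
      ext z
      induction z with | _ k l
      simp only [mem_filter, Finset.mk_mem_sym2_iff, Sym2.map_mk, Sym2.eq_iff, mem_image,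
        mem_product, Prod.exists]
      constructor
      · rintro ⟨⟨hk, hl⟩, ⟨h1, h2⟩ | ⟨h1, h2⟩⟩
        · exact ⟨k, l, ⟨⟨hk, h1⟩, hl, h2⟩, Or.inl ⟨rfl, rfl⟩⟩
        · exact ⟨l, k, ⟨⟨hl, h2⟩, hk, h1⟩, Or.inr ⟨rfl, rfl⟩⟩
      · rintro ⟨x, y, ⟨⟨hx, hxi⟩, hy, hyj⟩, ⟨rfl, rfl⟩ | ⟨rfl, rfl⟩⟩
        · exact ⟨⟨hx, hy⟩, Or.inl ⟨hxi, hyj⟩⟩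
        · exact ⟨⟨hy, hx⟩, Or.inr ⟨hyj, hxi⟩⟩
    rw [this, Finset.card_image_of_injOn, card_product, card_filter_range_mod hw.1,
      card_filter_range_mod hw.2, sq]
    rintro ⟨x, y⟩ hx ⟨x', y'⟩ hx' h
    simp only [coe_product, coe_filter, Set.mem_prod, Set.mem_ofPred_eq] at hx hx'
    simp only [Sym2.eq_iff] at h
    obtain ⟨rfl, rfl⟩ | ⟨rfl, rfl⟩ := h
    · rfl
    · exact absurd (hx.1.2.symm.trans hx'.2.2) hij

lemma card_sym2_range (a : ℕ) : #(range a).sym2 = a * (a + 1) / 2 := by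
  rw [Finset.card_sym2, card_range, Nat.choose_two_right, Nat.add_sub_cancel, mul_comm]

lemma card_sym2_range_not_isDiag (a : ℕ) :
    #((range a).sym2.filter fun w => ¬ w.IsDiag) = a * (a - 1) / 2 := by
  have h1 : (range a).sym2.filter (fun w => w.IsDiag) = (range a).image Sym2.diag := by
    ext z
    induction z with | _ i j
    simp only [mem_filter, Finset.mk_mem_sym2_iff, Sym2.mk_isDiag_iff, mem_image, Sym2.diag,
      Sym2.eq_iff]
    constructor
    · rintro ⟨⟨hi, -⟩, rfl⟩
      exact ⟨i, hi, by simp⟩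
    · rintro ⟨k, hk, ⟨rfl, rfl⟩ | ⟨rfl, rfl⟩⟩ <;> exact ⟨⟨hk, hk⟩, rfl⟩
  have h2 := Finset.card_filter_add_card_filter_not (s := (range a).sym2) (fun w => w.IsDiag)
  rw [h1, Finset.card_image_of_injective _ Sym2.diag_injective, card_range, card_sym2_range] at h2
  have h3 : a * (a + 1) / 2 = a * (a - 1) / 2 + a := by
    rcases a with _ | a
    · rfl
    · rw [Nat.add_sub_cancel, show (a + 1) * (a + 1 + 1) = (a + 1) * a + (a + 1) * 2 by ring,
        Nat.add_mul_div_right _ _ (by norm_num)]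
  omega

/-- The two rectangles of the staircase have together as many elements as there are unordered
pairs of integers in `[0, ab)`. -/
lemma staircase_area (a b : ℕ) :
    a * (a - 1) / 2 * b ^ 2 + (a * (a + 1) / 2 - a * (a - 1) / 2) * (b * (b + 1) / 2) =
      a * b * (a * b + 1) / 2 := by
  rcases a with _ | a
  · simp
  obtain ⟨x, hx⟩ := (Nat.even_mul_succ_self a)
  obtain ⟨y, hy⟩ := (Nat.even_mul_succ_self b)
  have h1 : (a + 1) * (a + 1 - 1) / 2 = x := by
    rw [Nat.add_sub_cancel, mul_comm, hx]; omega
  have h2 : (a + 1) * (a + 1 + 1) / 2 = x + (a + 1) := by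
    rw [show (a + 1) * (a + 1 + 1) = a * (a + 1) + (a + 1) * 2 by ring, hx]; omega
  have h3 : b * (b + 1) / 2 = y := by rw [hy]; omega
  rw [h1, h2, h3, Nat.add_sub_cancel_left]
  symm
  apply Nat.div_eq_of_eq_mul_left (by norm_num)
  have hx' : a * (a + 1) = 2 * x := by omega
  have hy' : b * (b + 1) = 2 * y := by omega
  calc (a + 1) * b * ((a + 1) * b + 1) = a * (a + 1) * b ^ 2 + (a + 1) * (b * (b + 1)) := by ring
    _ = _ := by rw [hx', hy']; ring

variable {a m n r₁ r₂ : ℕ}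

lemma map_mod_mem_sym2 {z : Sym2 ℕ} (ha : 0 < a) : z.map (· % a) ∈ (range a).sym2 := by
  induction z with | _ i j
  simp [Nat.mod_lt _ ha]

lemma natCast_pairPow_injOn (hn : n = 2 ^ m - 1) :
    Set.InjOn (fun z => (pairPow z : ZMod n)) ((range m).sym2 : Set (Sym2 ℕ)) := by
  subst hn
  exact pairPow_injOn_mod

lemma two_mul_mem_image (hn : n = 2 ^ m - 1) (T : ZMod n ≃+ ZMod r₁ × ZMod r₂) :
    ∀ e ∈ T '' (pairExponents m n : Set (ZMod n)),
      2 * e ∈ T '' (pairExponents m n : Set (ZMod n)) := by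
  rintro _ ⟨e, he, rfl⟩
  refine ⟨2 * e, two_mul_mem_pairExponents hn.dvd he, ?_⟩
  rw [two_mul, map_add, two_mul]

lemma exists_half_mem_image (hn : n = 2 ^ m - 1) (T : ZMod n ≃+ ZMod r₁ × ZMod r₂) :
    ∀ e ∈ T '' (pairExponents m n : Set (ZMod n)),
      ∃ d ∈ T '' (pairExponents m n : Set (ZMod n)), e = 2 * d := by
  rintro _ ⟨e, he, rfl⟩
  obtain ⟨d, hd, rfl⟩ := exists_half_mem_pairExponents hn.dvd he
  exact ⟨T d, ⟨d, hd, rfl⟩, by rw [two_mul, map_add, two_mul]⟩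

variable [NeZero n]

/-- An additive isomorphism from `ℤ / n` onto `ℤ / r₁ × ℤ / r₂` is linear for the multiplication
by `ℤ / n` on both sides. -/
lemma map_mul_eq (h : r₁ ∣ n) (h' : r₂ ∣ n) (T : ZMod n ≃+ ZMod r₁ × ZMod r₂) (e x : ZMod n) :
    T (e * x) = (ZMod.castHom h (ZMod r₁) e * (T x).1, ZMod.castHom h' (ZMod r₂) e * (T x).2) := by
  obtain ⟨k, rfl⟩ : ∃ k : ℕ, e = k := ⟨e.val, by simp⟩
  rw [← nsmul_eq_mul, map_nsmul, map_natCast, map_natCast, ← nsmul_eq_mul, ← nsmul_eq_mul]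
  rfl

lemma map_natCast_eq (h : r₁ ∣ n) (h' : r₂ ∣ n) (T : ZMod n ≃+ ZMod r₁ × ZMod r₂) (k : ℕ) :
    (T k).1 = k * (T 1).1 := by
  have := map_mul_eq h h' T k 1
  rw [mul_one] at this
  rw [this, map_natCast]

lemma natCast_eq_of_mul_map_one_eq (h : r₁ ∣ n) (h' : r₂ ∣ n) (T : ZMod n ≃+ ZMod r₁ × ZMod r₂)
    {x y : ZMod r₁} (hxy : x * (T 1).1 = y * (T 1).1) : x = y := by
  have h1 := map_mul_eq h h' T (T.symm (1, 0)) 1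
  rw [mul_one, T.apply_symm_apply] at h1
  have h2 : (T 1).1 * ZMod.castHom h (ZMod r₁) (T.symm (1, 0)) = 1 := by
    rw [mul_comm]; exact (Prod.ext_iff.1 h1).1.symm
  have h3 := congrArg (· * ZMod.castHom h (ZMod r₁) (T.symm (1, 0))) hxy
  simpa only [mul_assoc, h2, mul_one] using h3

/-- Over a point of the first projection of `T(D)`, where `D` is the set of the residues
`2 ^ i + 2 ^ j`, lie the images of the pairs `s(i, j)` with the same reduction modulo `a`. -/
lemma fibreCard_image_pairExponents {b : ℕ} [NeZero r₂] (hm : m = a * b)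
    (hn : n = 2 ^ m - 1) (hr₁ : r₁ = 2 ^ a - 1) (h : r₁ ∣ n) (h' : r₂ ∣ n) (ha : 0 < a)
    (T : ZMod n ≃+ ZMod r₁ × ZMod r₂) {w : Sym2 ℕ} (hw : w ∈ (range a).sym2) :
    fibreCard (T '' (pairExponents m n : Set (ZMod n))) (pairPow w * (T 1).1) =
      if w.IsDiag then b * (b + 1) / 2 else b ^ 2 := by
  classical
  subst hr₁
  have hfst (z : Sym2 ℕ) : (T (pairPow z : ZMod n)).1 = pairPow w * (T 1).1 ↔
      z.map (· % a) = w := by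
    rw [map_natCast_eq h h', ← pairPow_map_mod a z]
    refine ⟨fun he => ?_, fun he => by rw [he]⟩
    exact pairPow_injOn_mod (map_mod_mem_sym2 ha) hw (natCast_eq_of_mul_map_one_eq h h' T he)
  have hset : {y | ((pairPow w * (T 1).1, y) : ZMod (2 ^ a - 1) × ZMod r₂) ∈
      T '' (pairExponents m n : Set (ZMod n))} =
      (((range m).sym2.filter fun z => z.map (· % a) = w).image
        fun z => (T (pairPow z : ZMod n)).2 : Finset (ZMod r₂)) := by
    ext y
    simp only [Set.mem_ofPred_eq, Set.mem_image, mem_coe, pairExponents, mem_image, mem_filter]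
    constructor
    · rintro ⟨_, ⟨z, hz, rfl⟩, he⟩
      exact ⟨z, ⟨hz, (hfst z).1 (by rw [he])⟩, by rw [he]⟩
    · rintro ⟨z, ⟨hz, hzw⟩, rfl⟩
      exact ⟨_, ⟨z, hz, rfl⟩, Prod.ext ((hfst z).2 hzw) rfl⟩
  rw [fibreCard, hset, Set.ncard_coe_finset, Finset.card_image_of_injOn, hm,
    card_filter_map_mod hw]
  intro z hz z' hz' he
  rw [mem_coe, mem_filter] at hz hz'
  apply natCast_pairPow_injOn hn hz.1 hz'.1
  exact T.injective (Prod.ext (((hfst z).2 hz.2).trans ((hfst z').2 hz'.2).symm) he)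

lemma fst_image_pairExponents {b : ℕ} (hm : m = a * b)
    (hr₁ : r₁ = 2 ^ a - 1) (h : r₁ ∣ n) (h' : r₂ ∣ n) (ha : 0 < a) (hb : 0 < b)
    (T : ZMod n ≃+ ZMod r₁ × ZMod r₂) :
    Prod.fst '' (T '' (pairExponents m n : Set (ZMod n))) =
      (fun w => (pairPow w * (T 1).1 : ZMod r₁)) '' ((range a).sym2 : Set (Sym2 ℕ)) := by
  subst hr₁
  ext x
  simp only [Set.mem_image, mem_coe, pairExponents, mem_image]
  constructor
  · rintro ⟨_, ⟨_, ⟨z, hz, rfl⟩, rfl⟩, rfl⟩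
    exact ⟨z.map (· % a), map_mod_mem_sym2 ha, by rw [map_natCast_eq h h', pairPow_map_mod]⟩
  · rintro ⟨w, hw, rfl⟩
    refine ⟨_, ⟨_, ⟨w, ?_, rfl⟩, rfl⟩, map_natCast_eq h h' T _⟩
    refine Finset.sym2_mono (range_subset_range.2 ?_) hw
    rw [hm]
    exact Nat.le_mul_of_pos_right _ hb

/-- The number of points of the first projection of `T(D)` with at least `f` elements over them. -/
lemma ncard_fst_image_pairExponents {b : ℕ} [NeZero r₂] (hm : m = a * b)
    (hn : n = 2 ^ m - 1) (hr₁ : r₁ = 2 ^ a - 1) (h : r₁ ∣ n) (h' : r₂ ∣ n) (ha : 0 < a)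
    (hb : 0 < b) (T : ZMod n ≃+ ZMod r₁ × ZMod r₂) (f : ℕ) :
    {x ∈ Prod.fst '' (T '' (pairExponents m n : Set (ZMod n))) |
        f ≤ fibreCard (T '' (pairExponents m n : Set (ZMod n))) x}.ncard =
      #((range a).sym2.filter fun w => f ≤ if w.IsDiag then b * (b + 1) / 2 else b ^ 2) := by
  have hset : {x ∈ Prod.fst '' (T '' (pairExponents m n : Set (ZMod n))) |
        f ≤ fibreCard (T '' (pairExponents m n : Set (ZMod n))) x} =
      (fun w => (pairPow w * (T 1).1 : ZMod r₁)) ''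
        ((range a).sym2.filter fun w => f ≤ if w.IsDiag then b * (b + 1) / 2 else b ^ 2 :
          Finset (Sym2 ℕ)) := by
    rw [fst_image_pairExponents hm hr₁ h h' ha hb T]
    ext x
    simp only [Set.mem_ofPred_eq, Set.mem_image, mem_coe, mem_filter]
    constructor
    · rintro ⟨⟨w, hw, rfl⟩, hf⟩
      rw [fibreCard_image_pairExponents hm hn hr₁ h h' ha T hw] at hf
      exact ⟨w, ⟨hw, hf⟩, rfl⟩
    · rintro ⟨w, ⟨hw, hf⟩, rfl⟩
      refine ⟨⟨w, hw, rfl⟩, ?_⟩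
      rwa [fibreCard_image_pairExponents hm hn hr₁ h h' ha T hw]
  rw [hset, Set.InjOn.ncard_image, Set.ncard_coe_finset]
  intro z hz w hw he
  rw [mem_coe, mem_filter] at hz hw
  subst hr₁
  exact pairPow_injOn_mod hz.1 hw.1 (natCast_eq_of_mul_map_one_eq h h' T he)

lemma half_mul_succ_lt_sq {b : ℕ} (hb : 1 < b) : b * (b + 1) / 2 < b ^ 2 := by
  rw [Nat.div_lt_iff_lt_mul (by norm_num)]
  nlinarith

lemma isRestrictedReps_parameters {b : ℕ} [NeZero r₁] [NeZero r₂]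
    (hm : m = a * b) (hn : n = 2 ^ m - 1) (hr₁ : r₁ = 2 ^ a - 1) (h : r₁ ∣ n) (h' : r₂ ∣ n)
    (ha : 1 < a) (hb : 1 < b) (T : ZMod n ≃+ ZMod r₁ × ZMod r₂)
    {R : Finset (ZMod r₁ × ZMod r₂)}
    (hR : IsRestrictedReps R (T '' (pairExponents m n : Set (ZMod n)))) :
    sLen R = 2 ∧ fSeq R 1 = b ^ 2 ∧ fSeq R 2 = b * (b + 1) / 2 ∧
      gSeq R 1 = a * (a - 1) / 2 ∧ gSeq R 2 = a * (a + 1) / 2 ∧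
      gammaSet R = staircase a b r₁ r₂ := by
  have hlt := half_mul_succ_lt_sq hb
  have ha0 : 0 < a := by omega
  have hb0 : 0 < b := by omega
  refine hR.parameters (N := m) (by rw [hm]; positivity)
    (two_pow_eq_one_zmod (h.trans hn.dvd)) (two_pow_eq_one_zmod (h'.trans hn.dvd))
    (two_mul_mem_image hn T) hlt (fun k => ?_) ?_ ?_
  · rw [fst_image_pairExponents hm hr₁ h h' ha0 hb0 T]
    constructor
    · rintro ⟨_, ⟨w, hw, rfl⟩, rfl⟩
      rw [fibreCard_image_pairExponents hm hn hr₁ h h' ha0 T hw]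
      split_ifs
      · exact Or.inr rfl
      · exact Or.inl rfl
    · rintro (rfl | rfl)
      · have hw : s(0, 1) ∈ (range a).sym2 := by simp; omega
        exact ⟨_, ⟨_, hw, rfl⟩, by rw [fibreCard_image_pairExponents hm hn hr₁ h h' ha0 T hw]; simp⟩
      · have hw : s(0, 0) ∈ (range a).sym2 := by simp; omega
        exact ⟨_, ⟨_, hw, rfl⟩, by rw [fibreCard_image_pairExponents hm hn hr₁ h h' ha0 T hw]; simp⟩
  · rw [ncard_fst_image_pairExponents hm hn hr₁ h h' ha0 hb0 T, ← card_sym2_range_not_isDiag]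
    congr 1
    refine Finset.filter_congr fun w _ => ?_
    split_ifs with hd
    · simpa [hd] using hlt
    · simp [hd]
  · rw [ncard_fst_image_pairExponents hm hn hr₁ h h' ha0 hb0 T, Finset.filter_true_of_mem,
      card_sym2_range]
    intro w _
    split_ifs
    · exact le_rfl
    · exact hlt.le

end Counting

/-! ### Polynomials supported in a staircase -/

section Staircase

open Polynomial

variable {K : Type*} [Field K]

lemma eq_zero_of_sum_mul_pow_eq_zero {r : ℕ} [NeZero r] {c : ZMod r → K} {f : ℕ}
    (hc : ∀ j : ZMod r, f ≤ j.val → c j = 0) (S : Finset K) (hS : f ≤ #S)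
    (h : ∀ y ∈ S, ∑ j, c j * y ^ j.val = 0) : c = 0 := by
  classical
  set p : K[X] := ∑ j : ZMod r, C (c j) * X ^ j.val with hp
  have hcoeff (k : ℕ) : p.coeff k = ∑ j : ZMod r, if k = j.val then c j else 0 := by
    rw [hp, finsetSum_coeff]
    simp only [coeff_C_mul_X_pow]
  have hp0 : p = 0 := by
    apply eq_zero_of_degree_lt_of_eval_finset_eq_zero S
    · rw [degree_lt_iff_coeff_zero]
      intro k hk
      rw [hcoeff]
      refine Finset.sum_eq_zero fun j _ => ?_
      split_ifs with hkj
      · exact hc j (by omega)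
      · rfl
    · intro y hy
      rw [hp, eval_finsetSum]
      simpa using h y hy
  funext i
  have := hcoeff i.val
  rw [hp0, coeff_zero, Finset.sum_eq_single i] at this
  · simpa using this.symm
  · intro j _ hj
    rw [if_neg fun h => hj (ZMod.val_injective r h.symm)]
  · simp

/-- A polynomial in two variables supported in the staircase with steps `g × f` and `g' × f'`
vanishes if it has zeros above `g'` points of the first axis, `f'` zeros above each of them and `f`
zeros above `g` of them. Indeed its specialization at one of these `g` points has degree less than
`f`, so that the coefficients of `Y ^ j` with `f' ≤ j`, which have degree less than `g`, vanish; the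
same argument applies to the remaining polynomial with `g'` and `f'`. -/
lemma eq_zero_of_staircase {r₁ r₂ : ℕ} [NeZero r₁] [NeZero r₂] {f f' g g' : ℕ}
    (hf : f' ≤ f) {c : ZMod r₁ × ZMod r₂ → K}
    (hc : ∀ j, c j ≠ 0 → (j.1.val < g ∧ j.2.val < f) ∨
      (g ≤ j.1.val ∧ j.1.val < g' ∧ j.2.val < f'))
    (A A' : Finset K) (hAA : A ⊆ A') (hA : g ≤ #A) (hA' : g' ≤ #A') (hgg : g ≤ g')
    (Y : K → Finset K) (hY : ∀ x ∈ A, f ≤ #(Y x)) (hY' : ∀ x ∈ A', f' ≤ #(Y x))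
    (h : ∀ x ∈ A', ∀ y ∈ Y x, ∑ j, c j * (x ^ j.1.val * y ^ j.2.val) = 0) : c = 0 := by
  have hspec {x : K} (hx : x ∈ A') {k : ℕ} (hk : k ≤ #(Y x))
      (hz : ∀ j : ZMod r₂, k ≤ j.val → ∀ i, c (i, j) = 0) (j : ZMod r₂) :
      ∑ i, c (i, j) * x ^ i.val = 0 := by
    refine congrFun (eq_zero_of_sum_mul_pow_eq_zero
      (c := fun j => ∑ i, c (i, j) * x ^ i.val) (fun j hj => ?_) (Y x) hk fun y hy => ?_) j
    · refine Finset.sum_eq_zero fun i _ => ?_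
      rw [hz j hj, zero_mul]
    · rw [← h x hx y hy, Fintype.sum_prod_type_right]
      refine Finset.sum_congr rfl fun j _ => ?_
      rw [Finset.sum_mul]
      exact Finset.sum_congr rfl fun i _ => mul_assoc _ _ _
  have hhigh (j : ZMod r₂) (hj : f' ≤ j.val) (i : ZMod r₁) : c (i, j) = 0 := by
    refine congrFun (eq_zero_of_sum_mul_pow_eq_zero (c := fun i => c (i, j)) (fun i hi => ?_) A hA
      fun x hx => hspec (hAA hx) (hY x hx) (fun j' hj' i' => ?_) j) i
    · by_contra hne
      have := hc _ hne
      simp only at this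
      omega
    · by_contra hne
      have := hc _ hne
      simp only at this
      omega
  funext ⟨i, j⟩
  refine congrFun (eq_zero_of_sum_mul_pow_eq_zero (c := fun i => c (i, j)) (fun i hi => ?_) A' hA'
    fun x hx => hspec hx (hY' x hx) hhigh j) i
  by_contra hne
  have := hc _ hne
  simp only at this
  omega

lemma card_le_ncard_staircase {a b r₁ r₂ : ℕ} [NeZero r₁] [NeZero r₂] (hb : b ^ 2 ≤ r₂)
    (ha : a * (a + 1) / 2 ≤ r₁) (hb' : b * (b + 1) / 2 ≤ b ^ 2) :
    a * b * (a * b + 1) / 2 ≤ (staircase a b r₁ r₂).ncard := by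
  classical
  have haa : a * (a - 1) / 2 ≤ a * (a + 1) / 2 :=
    Nat.div_le_div_right (Nat.mul_le_mul_left _ (by omega))
  rw [← staircase_area]
  set g := a * (a - 1) / 2
  set g' := a * (a + 1) / 2
  set f' := b * (b + 1) / 2
  let U : Finset (ℕ × ℕ) := (range g ×ˢ range (b ^ 2)) ∪ (Ico g g' ×ˢ range f')
  have hU : #U = g * b ^ 2 + (g' - g) * f' := by
    rw [Finset.card_union_of_disjoint]
    · simp
    · rw [Finset.disjoint_left]
      rintro ⟨x, y⟩ h1 h2
      simp only [mem_product, mem_range, mem_Ico] at h1 h2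
      omega
  have hlt {p : ℕ × ℕ} (hp : p ∈ U) : p.1 < r₁ ∧ p.2 < r₂ := by
    simp only [U, mem_union, mem_product, mem_range, mem_Ico] at hp
    omega
  rw [← hU, ← Set.ncard_coe_finset]
  refine Set.ncard_le_ncard_of_injOn (fun p => ((p.1 : ZMod r₁), (p.2 : ZMod r₂))) ?_ ?_
  · intro p hp
    have h1 := hlt hp
    simp only [staircase, Set.mem_ofPred_eq, ZMod.val_cast_of_lt h1.1, ZMod.val_cast_of_lt h1.2]
    simp only [U, mem_coe, mem_union, mem_product, mem_range, mem_Ico] at hp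
    omega
  · intro p hp q hq hpq
    have hp1 := hlt hp
    have hq1 := hlt hq
    obtain ⟨h1, h2⟩ := Prod.ext_iff.1 hpq
    refine Prod.ext ?_ ?_
    · simpa [ZMod.val_cast_of_lt hp1.1, ZMod.val_cast_of_lt hq1.1] using congrArg ZMod.val h1
    · simpa [ZMod.val_cast_of_lt hp1.2, ZMod.val_cast_of_lt hq1.2] using congrArg ZMod.val h2

end Staircase

/-! ### Check positions -/

section CheckPositions

variable {K : Type*} [Field K]

/-- Suppose that the checks `χ e`, for `e ∈ E`, are closed under square roots, and that a word over
`K` supported in `J` and annihilated by them is zero, where `J` has at least as many elements as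
`E`. Then binary values outside `J` extend to a binary word annihilated by the checks. The extension
exists over `K` by linear algebra; its square is another one, so that it equals its square by
uniqueness. -/
lemma exists_binary_extension [Algebra (ZMod 2) K] {ι κ : Type*} [Fintype ι] (E : Finset κ)
    (χ : κ → ι → K) (hχ : ∀ e ∈ E, ∃ d ∈ E, ∀ i, χ e i = χ d i ^ 2) (J : Finset ι)
    (hcard : #E ≤ #J)
    (hinj : ∀ w : ι → K, (∀ i ∉ J, w i = 0) → (∀ e ∈ E, ∑ i, w i * χ e i = 0) → w = 0)
    (v : ι → ZMod 2) :
    ∃ c : ι → ZMod 2, (∀ e ∈ E, ∑ i, c i • χ e i = 0) ∧ ∀ i ∉ J, c i = v i := by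
  classical
  have := charP_two_of_algebra K
  let ext : (J → K) →ₗ[K] (ι → K) := Function.ExtendByZero.linearMap K ((↑) : J → ι)
  have hextJ (w : J → K) (i : ι) (hi : i ∉ J) : ext w i = 0 := by
    rw [Function.ExtendByZero.linearMap_apply, Function.extend_apply']
    · rfl
    · rintro ⟨j, rfl⟩
      exact hi j.2
  have hext (w : J → K) (j : J) : ext w j = w j :=
    Subtype.val_injective.extend_apply _ _ _
  let ev : (ι → K) →ₗ[K] (E → K) := LinearMap.pi fun e => Fintype.linearCombination K (χ e)
  have hev (w : ι → K) (e : E) : ev w e = ∑ i, w i * χ e i := rfl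
  have hLinj : Function.Injective (ev ∘ₗ ext) := by
    rw [injective_iff_map_eq_zero]
    intro w hw
    have h0 : ext w = 0 := hinj _ (hextJ w) fun e he => by
      rw [← hev _ ⟨e, he⟩]; exact congrFun hw ⟨e, he⟩
    funext j
    rw [← hext w j, h0]; rfl
  have hLsurj : Function.Surjective (ev ∘ₗ ext) := by
    have hle := LinearMap.finrank_le_finrank_of_injective hLinj
    simp only [Module.finrank_fintype_fun_eq_card, Fintype.card_coe] at hle
    rwa [← LinearMap.injective_iff_surjective_of_finrank_eq_finrank]
    simp only [Module.finrank_fintype_fun_eq_card, Fintype.card_coe]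
    omega
  obtain ⟨w, hw⟩ := hLsurj (- ev fun i => algebraMap (ZMod 2) K (if i ∈ J then 0 else v i))
  set x : ι → K := ext w + fun i => algebraMap (ZMod 2) K (if i ∈ J then 0 else v i) with hx
  have hx0 (e) (he : e ∈ E) : ∑ i, x i * χ e i = 0 := by
    rw [← hev _ ⟨e, he⟩, hx, map_add]
    change (ev ∘ₗ ext) w _ + _ = 0
    rw [hw]
    simp
  have hxJ (i) (hi : i ∉ J) : x i = algebraMap (ZMod 2) K (v i) := by
    rw [hx, Pi.add_apply, hextJ w i hi, if_neg hi, zero_add]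
  have hsq : (fun i => x i ^ 2 - x i) = 0 := by
    apply hinj
    · intro i hi
      rw [hxJ i hi, ← map_pow, ZMod.pow_card, sub_self]
    · intro e he
      simp_rw [sub_mul]
      rw [Finset.sum_sub_distrib, hx0 e he, sub_zero]
      obtain ⟨d, hd, hde⟩ := hχ e he
      simp_rw [hde, ← mul_pow]
      rw [← sum_pow_char, hx0 d hd, zero_pow two_ne_zero]
  choose c hc using fun i => exists_algebraMap_eq_of_sq_eq (sub_eq_zero.1 (congrFun hsq i))
  refine ⟨c, fun e he => ?_, fun i hi => (algebraMap (ZMod 2) K).injective ?_⟩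
  · simp_rw [Algebra.smul_def, hc]
    exact hx0 e he
  · rw [hc, hxJ i hi]

lemma expChar_apply_eq {n : ℕ} [NeZero n] {ζ : K} (h : ζ ^ n = 1) (e i : ZMod n) :
    expChar h e i = ζ ^ (e * i).val := by
  rw [expChar_apply, ← pow_mul, ← pow_val_natCast h (e.val * i.val)]
  simp

lemma expChar_symm_apply {n r₁ r₂ : ℕ} [NeZero n] [NeZero r₁] [NeZero r₂] {ζ : K} (h : ζ ^ n = 1)
    (T : ZMod n ≃+ ZMod r₁ × ZMod r₂) (e : ZMod n) (j : ZMod r₁ × ZMod r₂) :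
    expChar h e (T.symm j) =
      expChar h e (T.symm (1, 0)) ^ j.1.val * expChar h e (T.symm (0, 1)) ^ j.2.val := by
  rw [← AddChar.map_nsmul_eq_pow, ← AddChar.map_nsmul_eq_pow, ← AddChar.map_add_eq_mul,
    ← map_nsmul, ← map_nsmul, ← map_add]
  congr 2
  ext <;> simp

variable {a b m n r₁ r₂ : ℕ} [NeZero n] {α : K}

/-- In terms of the coordinates given by `T`, the character with exponent `e` is the evaluation of
monomials at a point of `K × K`. Its first coordinate depends on `e` modulo `r₁` only, and
determines it. -/
lemma expChar_symm_eq_iff (hα : IsPrimitiveRoot α n) (h : r₁ ∣ n) (h' : r₂ ∣ n)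
    (T : ZMod n ≃+ ZMod r₁ × ZMod r₂) (e d : ZMod n) :
    expChar hα.pow_eq_one e (T.symm (1, 0)) = expChar hα.pow_eq_one d (T.symm (1, 0)) ↔
      ZMod.castHom h (ZMod r₁) e = ZMod.castHom h (ZMod r₁) d := by
  rw [expChar_apply_eq, expChar_apply_eq, (pow_val_injective hα).eq_iff, ← T.injective.eq_iff,
    map_mul_eq h h', map_mul_eq h h', T.apply_symm_apply]
  simp

variable [NeZero r₁] [NeZero r₂]

/-- A word supported in the staircase and orthogonal to the characters `2 ^ i + 2 ^ j` is zero: in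
the coordinates given by `T` it is a polynomial in two variables, whose zeros are distributed as in
`card_filter_map_mod`. -/
lemma eq_zero_of_staircase_of_pairExponents (hm : m = a * b) (hn : n = 2 ^ m - 1)
    (hr₁ : r₁ = 2 ^ a - 1) (h : r₁ ∣ n) (h' : r₂ ∣ n) (ha : 0 < a) (hb : 1 < b)
    (hα : IsPrimitiveRoot α n) (T : ZMod n ≃+ ZMod r₁ × ZMod r₂) {c : ZMod n → K}
    (hc : ∀ i, c i ≠ 0 → T i ∈ staircase a b r₁ r₂)
    (h0 : ∀ e ∈ pairExponents m n, ∑ i, c i * expChar hα.pow_eq_one e i = 0) : c = 0 := by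
  classical
  subst hr₁
  set χ := expChar hα.pow_eq_one with hχ
  let x (z : Sym2 ℕ) : K := χ (pairPow z) (T.symm (1, 0))
  let y (z : Sym2 ℕ) : K := χ (pairPow z) (T.symm (0, 1))
  have hx (z w : Sym2 ℕ) : x z = x w ↔
      (pairPow z : ZMod (2 ^ a - 1)) = (pairPow w : ZMod (2 ^ a - 1)) := by
    simp only [x, hχ, expChar_symm_eq_iff hα h h' T, map_natCast]
  have hxinj : Set.InjOn x ((range a).sym2 : Set (Sym2 ℕ)) :=
    fun z hz w hw hzw => pairPow_injOn_mod hz hw ((hx z w).1 hzw)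
  have hsum (z : Sym2 ℕ) (hz : z ∈ (range m).sym2) :
      ∑ j, c (T.symm j) * (x z ^ j.1.val * y z ^ j.2.val) = 0 := by
    rw [← h0 _ (mem_image_of_mem _ hz), ← Equiv.sum_comp T.symm.toEquiv]
    refine Finset.sum_congr rfl fun j _ => ?_
    rw [← expChar_symm_apply hα.pow_eq_one T]
    rfl
  let Y (u : K) : Finset K := ((range m).sym2.filter fun z => x z = u).image y
  have hYcard (w : Sym2 ℕ) (hw : w ∈ (range a).sym2) :
      (if w.IsDiag then b * (b + 1) / 2 else b ^ 2) ≤ #(Y (x w)) := by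
    rw [Finset.card_image_of_injOn, ← card_filter_map_mod hw, ← hm]
    · refine Finset.card_le_card fun z hz => ?_
      rw [mem_filter] at hz ⊢
      exact ⟨hz.1, by rw [hx, ← pairPow_map_mod a z, hz.2]⟩
    · intro z hz z' hz' hy
      rw [mem_coe, mem_filter] at hz hz'
      apply natCast_pairPow_injOn hn hz.1 hz'.1
      apply expChar_injective hα
      ext i
      rw [← T.symm_apply_apply i, expChar_symm_apply _ T _ (T i), expChar_symm_apply _ T _ (T i)]
      congr 2
      exact hz.2.trans hz'.2.symm
  have hlt := half_mul_succ_lt_sq hb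
  have hmain : (fun j => c (T.symm j)) = 0 := by
    refine eq_zero_of_staircase (f := b ^ 2) (f' := b * (b + 1) / 2) (g := a * (a - 1) / 2)
      (g' := a * (a + 1) / 2) hlt.le (fun j hj => ?_)
      (((range a).sym2.filter fun w => ¬ w.IsDiag).image x) ((range a).sym2.image x)
      (Finset.image_subset_image (Finset.filter_subset _ _)) ?_ ?_ ?_ Y ?_ ?_ ?_
    · simpa [staircase] using hc _ hj
    · rw [Finset.card_image_of_injOn (hxinj.mono (Finset.coe_subset.2 (Finset.filter_subset _ _))), card_sym2_range_not_isDiag]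
    · rw [Finset.card_image_of_injOn hxinj, card_sym2_range]
    · exact Nat.div_le_div_right (Nat.mul_le_mul_left _ (by omega))
    · intro u hu
      obtain ⟨w, hw, rfl⟩ := mem_image.1 hu
      rw [mem_filter] at hw
      simpa [hw.2] using hYcard w hw.1
    · intro u hu
      obtain ⟨w, hw, rfl⟩ := mem_image.1 hu
      refine le_trans ?_ (hYcard w hw)
      split_ifs
      · exact le_rfl
      · exact hlt.le
    · intro u _ v hv
      obtain ⟨z, hz, rfl⟩ := mem_image.1 hv
      obtain ⟨hzm, rfl⟩ := mem_filter.1 hz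
      exact hsum z hzm
  funext i
  simpa using congrFun hmain (T i)

variable [Fintype K] [Algebra (ZMod 2) K]

lemma isCheckPositions_puncture (hm : m = a * b) (hn : n = 2 ^ m - 1) (hr₁ : r₁ = 2 ^ a - 1)
    (h : r₁ ∣ n) (h' : r₂ ∣ n) (ha : 1 < a) (hb : 1 < b) (hK : Fintype.card K = 2 ^ m)
    (hα : IsPrimitiveRoot α n) (T : ZMod n ≃+ ZMod r₁ × ZMod r₂) :
    IsCheckPositions (puncture α (reedMuller K (m - 3) m)) (T ⁻¹' staircase a b r₁ r₂) := by
  classical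
  have hm3 : 3 ≤ m := by
    have : 2 * 2 ≤ a * b := Nat.mul_le_mul ha hb
    omega
  have hlt := half_mul_succ_lt_sq hb
  have hinj : ∀ w : ZMod n → K, (∀ i ∉ (T ⁻¹' staircase a b r₁ r₂).toFinset, w i = 0) →
      (∀ e ∈ pairExponents m n, ∑ i, w i * expChar hα.pow_eq_one e i = 0) → w = 0 := by
    intro w hw h0
    refine eq_zero_of_staircase_of_pairExponents hm hn hr₁ h h' (by omega) hb hα T
      (fun i hi => ?_) h0
    by_contra hT
    exact hi (hw i (by simpa using hT))
  rw [IsCheckPositions, isInformationSet_iff]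
  constructor
  · intro c hc hc0
    rw [mem_puncture_iff hα hn hK hm3] at hc
    have := hinj (fun i => algebraMap (ZMod 2) K (c i))
      (fun i hi => by rw [hc0 i (by simpa using hi), map_zero])
      (fun e he => by simpa [Algebra.smul_def] using hc e he)
    funext i
    exact (algebraMap (ZMod 2) K).injective ((congrFun this i).trans (map_zero _).symm)
  · intro v
    have hcard : #(pairExponents m n) ≤ #(T ⁻¹' staircase a b r₁ r₂).toFinset := by
      rw [← Set.ncard_eq_toFinset_card', Set.ncard_preimage_of_injective_subset_range T.injective
        (by simp [T.surjective.range_eq])]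
      refine (Finset.card_image_le.trans ?_).trans (card_le_ncard_staircase ?_ ?_ hlt.le)
      · rw [card_sym2_range, hm]
      · -- `s(0, 1)` has `b ^ 2` pairs over it, with distinct second coordinates in `ℤ / r₂`
        have hw : s(0, 1) ∈ (range a).sym2 := by simp; omega
        have hfib := fibreCard_image_pairExponents hm hn hr₁ h h' (by omega) T hw
        rw [if_neg (by simp)] at hfib
        rw [← hfib, fibreCard]
        refine (Set.ncard_le_card _).trans ?_
        rw [Nat.card_eq_fintype_card, ZMod.card]
      · subst hr₁
        rw [← card_sym2_range, ← Finset.card_image_of_injOn pairPow_injOn_mod]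
        refine (Finset.card_le_univ _).trans ?_
        rw [ZMod.card]
    obtain ⟨c, hc, hcv⟩ := exists_binary_extension (pairExponents m n)
      (fun e i => expChar hα.pow_eq_one e i)
      (fun e he => by
        obtain ⟨d, hd, rfl⟩ := exists_half_mem_pairExponents hn.dvd he
        exact ⟨d, hd, fun i => by rw [expChar_two_mul, AddChar.pow_apply]⟩)
      _ hcard hinj v
    exact ⟨c, (mem_puncture_iff hα hn hK hm3).2 hc, fun i hi => hcv i (by simpa using hi)⟩

end CheckPositions

end ReedMullerInfo

open ReedMullerInfo in
theorem mainTheorem1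
    (a b m n r₁ r₂ : ℕ) [NeZero n] (hm : m = a * b) (hn : n = 2 ^ m - 1) (hnr : n = r₁ * r₂)
    (hr₁ : r₁ = 2 ^ a - 1) (hcop : Nat.Coprime r₁ r₂) (h₁ : 1 < r₁) (h₂ : 1 < r₂)
    (K : Type*) [Field K] [Fintype K] [Algebra (ZMod 2) K] (hK : Fintype.card K = 2 ^ m)
    (α : K) (hα : IsPrimitiveRoot α n) (T : ZMod n ≃+ ZMod r₁ × ZMod r₂) :
    -- The parameters, for every abelian code with defining set `T(D*)` (such codes exist), with
    -- respect to any primitive roots of unity, and every set of restricted representatives.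
    (∀ β₁ β₂ : K, IsPrimitiveRoot β₁ r₁ → IsPrimitiveRoot β₂ r₂ →
      (∃ C : Ideal (AbelianAlgebra r₁ r₂), abelianDefiningSet β₁ β₂ C =
        T '' cyclicDefiningSet α (puncture α (reedMuller K (m - 3) m))) ∧
      ∀ C : Ideal (AbelianAlgebra r₁ r₂), abelianDefiningSet β₁ β₂ C =
          T '' cyclicDefiningSet α (puncture α (reedMuller K (m - 3) m)) →
        (∃ R, IsRestrictedReps R (abelianDefiningSet β₁ β₂ C)) ∧
        ∀ R, IsRestrictedReps R (abelianDefiningSet β₁ β₂ C) →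
          sLen R = 2 ∧
          fSeq R 1 = b ^ 2 ∧ fSeq R 2 = b * (b + 1) / 2 ∧
          gSeq R 1 = a * (a - 1) / 2 ∧ gSeq R 2 = a * (a + 1) / 2 ∧
          gammaSet R = staircase a b r₁ r₂) ∧
    -- Check positions for `R*(m - 3, m)`, and information sets for `R(2, m)` and `R(m - 3, m)`.
    IsCheckPositions (puncture α (reedMuller K (m - 3) m)) (T ⁻¹' staircase a b r₁ r₂) ∧
    IsInformationSet (reedMuller K 2 m)
      (insert 0 ((fun i : ZMod n => α ^ i.val) '' (T ⁻¹' staircase a b r₁ r₂))) ∧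
    IsInformationSet (reedMuller K (m - 3) m)
      ((fun i : ZMod n => α ^ i.val) '' (T ⁻¹' staircase a b r₁ r₂)ᶜ) := by
  have : NeZero r₁ := ⟨by omega⟩
  have : NeZero r₂ := ⟨by omega⟩
  have hd₁ : r₁ ∣ n := ⟨r₂, hnr⟩
  have hd₂ : r₂ ∣ n := ⟨r₁, by rw [hnr, mul_comm]⟩
  have ha : 1 < a := by
    by_contra ha
    obtain rfl | rfl : a = 0 ∨ a = 1 := by omega
    · simp at hr₁; omega
    · simp at hr₁; omega
  have hb : 1 < b := by
    -- `b = 0` gives `n = 0` and `b = 1` gives `n = r₁`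
    by_contra hb
    obtain rfl | rfl : b = 0 ∨ b = 1 := by omega
    · rw [hm, mul_zero, pow_zero] at hn
      exact NeZero.ne n hn
    · rw [hm, mul_one, ← hr₁, hnr] at hn
      have := Nat.eq_of_mul_eq_mul_left (by omega) (hn.trans (mul_one r₁).symm)
      omega
  have hm3 : 3 ≤ m := by
    have : 2 * 2 ≤ a * b := Nat.mul_le_mul ha hb
    omega
  have hcheck := isCheckPositions_puncture hm hn hr₁ hd₁ hd₂ ha hb hK hα T
  have hinfo := IsInformationSet.of_puncture hα hn hK hm3 hcheck
  refine ⟨fun β₁ β₂ hβ₁ hβ₂ => ?_, hcheck, ?_, hinfo⟩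
  · rw [cyclicDefiningSet_puncture hα hn hK hm3]
    refine ⟨exists_abelianDefiningSet_eq hK (by omega) hβ₁ hβ₂ (exists_half_mem_image hn T),
      fun C hC => ?_⟩
    rw [hC]
    exact ⟨exists_isRestrictedReps (N := m) (by omega) (two_pow_eq_one_zmod (hd₁.trans hn.dvd))
        (two_pow_eq_one_zmod (hd₂.trans hn.dvd)) (two_mul_mem_image hn T),
      fun R hR => isRestrictedReps_parameters hm hn hr₁ hd₁ hd₂ ha hb T hR⟩
  · convert hinfo.dual (mem_reedMuller_two_iff hK hm3) using 1
    -- the nonzero elements of the field are the powers of `α`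
    ext g
    simp only [Set.mem_insert_iff, Set.mem_image, Set.mem_compl_iff, not_exists, not_and]
    constructor
    · rintro (rfl | ⟨i, hi, rfl⟩) j hj hji
      · exact hα.ne_zero (NeZero.ne n) (eq_zero_of_pow_eq_zero hji)
      · rw [pow_val_injective hα hji] at hj
        exact hj hi
    · intro hg
      by_cases hg0 : g = 0
      · exact Or.inl hg0
      · obtain ⟨i, rfl⟩ := exists_pow_val_eq hα (by rw [hn, hK]) hg0
        refine Or.inr ⟨i, ?_, rfl⟩
        by_contra hi
        exact hg i hi rfl
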